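/- **Conventions.** $\|\cdot\|_F$ is the Frobenius norm, $\|\cdot\|$ the $\ell_2$ norm of a vector, $A(i,\cdot)$ the $i$-th row of $A$, $\dagger$ the conjugate transpose. For a nonzero $A\in\mathbb{C}^{m\times n}$ let $p_{\mathrm{row}(A)}(i)=\|A(i,\cdot)\|^2/\|A\|_F^2$ for $i\in\{1,\dots,m\}$. For a positive semidefinite Hermitian $H=\sum_i\lambda_i v_iv_i^\dagger$ (with $\{v_i\}_i$ an orthonormal basis of eigenvectors) and $g\colon\mathbb{R}_{\ge 0}\to\mathbb{C}$ let $g(H)=\sum_i g(\lambda_i)v_iv_i^\dagger$, and for $\chi\ge 0$ let $\mathrm{spec}_\chi(H)=\{x\in\mathbb{R}_{\ge0} : |x-\lambda_i|\le\chi\text{ for some } i\}$. *Smoothness.* $f\colon\mathbb{R}_{\ge0}\to\mathbb{C}$ is $(L,\bar L)$-smooth on $\Lambda\subseteq\mathbb{R}_{\ge0}$ if $f(0)=0$, the limit of $f(x)/x$ as $x\to0$ exists, $|f(x)-f(y)|\le L|x-y|$ for all $x,y\in\Lambda$, and $|\bar f(x)-\bar f(y)|\le\bar L|x-y|$ for all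 $x,y\in\Lambda$, where $\bar f(x)=f(x)/x$ for $x>0$ and $\bar f(0)=\lim_{x\to0}f(x)/x$. *Sketches.* Given probability distributions $p,\tilde p$ on $\{1,\dots,m\}$, the $r\times m$ matrix sampled according to $(p,\tilde p)$ is the random real matrix $S$ obtained by drawing $s_1,\dots,s_r$ independently from $\tilde p$ and letting the $i$-th row of $S$ be $e_{s_i}/\sqrt{r\,p(s_i)}$ if $p(s_i)>0$ and $0$ otherwise. An $(r,\varepsilon,\phi)$-approximate importance matrix sketch of a nonzero $A\in\mathbb{C}^{m\times n}$ is a random matrix sampled according to $(p,\tilde p)$ for some probability distributions $p,\tilde p$ with $p(i)\ge\frac1\phi p_{\mathrm{row}(A)}(i)$ for all $i$ and $\frac12\sum_i|\tilde p(i)-p(i)|\le\varepsilon$. **Theorem.** Let $A\in\mathbb{C}^{m\times n}$ be a nonzero matrix and $f\colon\mathbb{R}_{\ge0}\to\mathbb{C}$ an $(L,\bar L)$-smooth function on $\mathrm{spec}_\chi(A^\dagger A)$, for some $L,\bar L,\chi>0$. Let $\delta\in(0,1]$, $\gamma>0$ and $\phi,\phi'\ge1$, and let $\varepsilon\ge0$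 and the integers $r\in\{1,\dots,m\}$, $c\in\{1,\dots,n\}$ satisfy $$\varepsilon\le\min\left(\frac1{8\phi},\ \frac{\chi}{24(\phi+\phi')\|A\|_F^2},\ \frac{\gamma}{24L\phi\|A\|_F^2},\ \frac{\gamma}{48\bar L\phi'\|A\|_F^4}\right),$$ $$r\ge\max\left(2\phi^2\ln(6/\delta),\ 112\,\phi^2\|A\|_F^4\left(\frac{\ln(6/\delta)}{\chi^2}+\frac{\ln(6/\delta)L^2}{\gamma^2}\right)\right),$$ $$c\ge112\,\phi'^2\|A\|_F^4\left(\frac{\ln(6/\delta)}{\chi^2}+\frac{4\ln(6/\delta)\bar L^2\|A\|_F^4}{\gamma^2}\right).$$ Let $S\in\mathbb{R}^{r\times m}$ be an $(r,\varepsilon,\phi)$-approximate importance matrix sketch of $A$ and let $T\in\mathbb{R}^{c\times n}$ be, conditionally on $S$ and whenever $SA\ne0$, a $(c,\varepsilon,\phi')$-approximate importance matrix sketch of $(SA)^\dagger$ (if $SA=0$, $T$ is arbitrary). Then for $R=SA$ and $C=SAT^\dagger$, with probability at least $1-\delta$, $$\left\|R^\dagger\,\bar f(CC^\dagger)\,R-f(A^\dagger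 A)\right\|_F\le\gamma .$$ -/

import Mathlib

open MeasureTheory ProbabilityTheory Filter Topology
open scoped NNReal ENNReal ComplexOrder Matrix Matrix.Norms.Frobenius

/-! Throughout, the norm of a matrix is the Frobenius norm (see `open scoped` above),
and probability distributions on `Fin m` are the points of `stdSimplex ℝ (Fin m)`. -/

/-- For a positive semidefinite Hermitian `H` and `χ ≥ 0`, the set `spec_χ(H)` of the nonnegative
reals at distance at most `χ` from some eigenvalue of `H`. -/
noncomputable def specNhd {n : ℕ} (χ : ℝ) {H : Matrix (Fin n) (Fin n) ℂ}
    (hH : H.PosSemidef) : Set ℝ≥0 :=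
  {x | ∃ z ∈ Set.range hH.isHermitian.eigenvalues, |(x : ℝ) - z| ≤ χ}

/-- The singular value transformation `f(H) = ∑ i, f(λ_i) v_i v_i†` of a positive semidefinite
Hermitian matrix `H` with eigenvalues `λ_i` and an orthonormal basis of eigenvectors `v_i`. -/
noncomputable def singularValueTransformation {n : ℕ} (f : ℝ≥0 → ℂ)
    {H : Matrix (Fin n) (Fin n) ℂ} (hH : H.PosSemidef) : Matrix (Fin n) (Fin n) ℂ :=
  ∑ i, f ⟨hH.isHermitian.eigenvalues i, hH.eigenvalues_nonneg i⟩ •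
    Matrix.vecMulVec (hH.isHermitian.eigenvectorBasis i : Fin n → ℂ)
      (star (hH.isHermitian.eigenvectorBasis i : Fin n → ℂ))

/-- `f̄(x) = f(x)/x` for `x > 0`, and `f̄(0)` is the limit of `f(x)/x` as `x → 0`. -/
noncomputable def fbar (f : ℝ≥0 → ℂ) (x : ℝ≥0) : ℂ :=
  if x = 0 then limUnder (𝓝[≠] (0 : ℝ≥0)) (fun y : ℝ≥0 => f y / ((y : ℝ) : ℂ))
  else f x / ((x : ℝ) : ℂ)

/-- `f` is `(L, L̄)`-smooth on `Λ`. -/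
structure IsSmoothOn (f : ℝ≥0 → ℂ) (L Lbar : ℝ) (Λ : Set ℝ≥0) : Prop where
  map_zero : f 0 = 0
  limit_exists : ∃ c : ℂ,
    Tendsto (fun x : ℝ≥0 => f x / ((x : ℝ) : ℂ)) (𝓝[≠] (0 : ℝ≥0)) (𝓝 c)
  lipschitz : ∀ x ∈ Λ, ∀ y ∈ Λ, ‖f x - f y‖ ≤ L * |(x : ℝ) - (y : ℝ)|
  lipschitz_fbar : ∀ x ∈ Λ, ∀ y ∈ Λ, ‖fbar f x - fbar f y‖ ≤ Lbar * |(x : ℝ) - (y : ℝ)|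

/-- The distribution `p_{row(A)}`: `i ↦ ‖A(i,·)‖² / ‖A‖_F²`, with the `ℓ₂` norm of the row. -/
noncomputable def rowDist {m n : ℕ} (A : Matrix (Fin m) (Fin n) ℂ) (i : Fin m) : ℝ :=
  (∑ j, ‖A i j‖ ^ 2) / ‖A‖ ^ 2

/-- The total variation distance of two distributions on `Fin m`. -/
noncomputable def tvDist {m : ℕ} (p q : Fin m → ℝ) : ℝ :=
  (1 / 2) * ∑ i, |p i - q i|

/-- The `r × m` matrix whose `i`-th row is `e_{s i} / √(r p(s i))` if `p (s i) > 0`,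
and `0` otherwise. -/
noncomputable def sampleMatrix {r m : ℕ} (p : Fin m → ℝ) (s : Fin r → Fin m) :
    Matrix (Fin r) (Fin m) ℝ :=
  fun i j => if 0 < p (s i) ∧ j = s i then 1 / √((r : ℝ) * p (s i)) else 0

/-- The random matrix `S` is sampled according to `(p, pt)`: its rows come from independent
indices, each of them distributed according to `pt`, rescaled with `p`. -/
def IsSampledAccordingTo {Ω : Type*} [MeasurableSpace Ω] (P : Measure Ω) {r m : ℕ}
    (p pt : Fin m → ℝ) (S : Ω → Matrix (Fin r) (Fin m) ℝ) : Prop :=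
  ∃ s : Fin r → Ω → Fin m,
    (∀ i, Measurable (s i)) ∧
    iIndepFun s P ∧
    (∀ i j, P {ω | s i ω = j} = ENNReal.ofReal (pt j)) ∧
    ∀ᵐ ω ∂P, S ω = sampleMatrix p (fun i => s i ω)

/-- Under the probability measure `P`, the random `r × m` matrix `S` is an
`(r, ε, φ)`-approximate importance matrix sketch of the (nonzero) matrix `A`. -/
def IsApproxImportanceSketch {Ω : Type*} [MeasurableSpace Ω] (P : Measure Ω) {r m n : ℕ}
    (ε φ : ℝ) (A : Matrix (Fin m) (Fin n) ℂ) (S : Ω → Matrix (Fin r) (Fin m) ℝ) : Prop :=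
  ∃ p ∈ stdSimplex ℝ (Fin m), ∃ pt ∈ stdSimplex ℝ (Fin m),
    (∀ i, (1 / φ) * rowDist A i ≤ p i) ∧
    tvDist pt p ≤ ε ∧
    IsSampledAccordingTo P p pt S

/-- `R = S A` for a real matrix `S` and a complex matrix `A`. -/
noncomputable def sketchR {r m n : ℕ} (S : Matrix (Fin r) (Fin m) ℝ)
    (A : Matrix (Fin m) (Fin n) ℂ) : Matrix (Fin r) (Fin n) ℂ :=
  S.map Complex.ofReal * A

/-- `C = S A T†` for real matrices `S`, `T` and a complex matrix `A`. -/
noncomputable def sketchC {r m n c : ℕ} (S : Matrix (Fin r) (Fin m) ℝ)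
    (A : Matrix (Fin m) (Fin n) ℂ) (T : Matrix (Fin c) (Fin n) ℝ) :
    Matrix (Fin r) (Fin c) ℂ :=
  S.map Complex.ofReal * A * (T.map Complex.ofReal)ᴴ

/-! Since `f(RᴴR) = Rᴴ f̄(RRᴴ) R`, the error splits into `f(RᴴR) - f(AᴴA)` and
`Rᴴ (f̄(CCᴴ) - f̄(RRᴴ)) R`. In eigenbases of the two matrices involved, the entries of `f(X) - f(Y)`
are those of `X - Y` multiplied by divided differences of `f`, so a Lipschitz bound for `f` at the
eigenvalues bounds the Frobenius norm of the difference. By a weak form of Weyl's inequality, the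
relevant eigenvalues of `RᴴR`, `RRᴴ` and `CCᴴ` lie in `spec_χ(AᴴA)` once `‖RᴴR - AᴴA‖` and
`‖CCᴴ - RRᴴ‖` add up to at most `χ`; the eigenvectors of `RRᴴ` and `CCᴴ` in the kernel of `Rᴴ`,
whose eigenvalue `0` may lie outside of it, do not contribute.

The random matrices `RᴴR` and `CCᴴ` are averages of independent bounded matrices whose means are
within `O(ε)` of `AᴴA` and `RRᴴ`. Pinelis' dimension-free Hoeffding inequality in the Hilbert space
of matrices bounds their deviations, conditionally on `S` for the second sketch, and Hoeffding's
inequality bounds `‖R‖²`. -/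

section VectorHoeffding

/-- `cosh ∘ √` is convex since all coefficients of its power series are nonnegative. -/
theorem convexOn_cosh_sqrt : ConvexOn ℝ (Set.Ici (0 : ℝ)) fun u => Real.cosh √u := by
  have hasSum_cosh_sqrt (u : ℝ) (hu : 0 ≤ u) :
      HasSum (fun k : ℕ => u ^ k / ((2 * k).factorial : ℝ)) (Real.cosh √u) := by
    simpa only [pow_mul, Real.sq_sqrt hu] using Real.hasSum_cosh √u
  refine ⟨convex_Ici 0, fun x hx y hy a b ha hb hab => ?_⟩
  refine hasSum_le (fun k => ?_)
    (hasSum_cosh_sqrt _ (convex_Ici (0 : ℝ) hx hy ha hb hab))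
    (((hasSum_cosh_sqrt x hx).mul_left a).add ((hasSum_cosh_sqrt y hy).mul_left b))
  calc (a • x + b • y) ^ k / ((2 * k).factorial : ℝ)
      ≤ (a • x ^ k + b • y ^ k) / ((2 * k).factorial : ℝ) := by
        gcongr
        exact (convexOn_pow k).2 hx hy ha hb hab
    _ = a * (x ^ k / ((2 * k).factorial : ℝ)) + b * (y ^ k / ((2 * k).factorial : ℝ)) := by
        simp only [smul_eq_mul]
        ring

theorem measureReal_norm_ge_le_integral_cosh {E : Type*} [NormedAddCommGroup E] {Ω : Type*}
    [MeasurableSpace Ω] {P : Measure Ω} [IsFiniteMeasure P] {X : Ω → E}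
    (hX : Integrable (fun ω => Real.cosh ‖X ω‖) P) (τ : ℝ) :
    P.real {ω | τ ≤ ‖X ω‖} ≤ 2 * Real.exp (-τ) * ∫ ω, Real.cosh ‖X ω‖ ∂P := by
  have hmarkov := mul_meas_ge_le_integral_of_nonneg (.of_forall fun _ => (Real.cosh_pos _).le) hX
    (Real.exp τ / 2)
  calc P.real {ω | τ ≤ ‖X ω‖}
      ≤ P.real {ω | Real.exp τ / 2 ≤ Real.cosh ‖X ω‖} := by
        refine measureReal_mono fun ω (hω : τ ≤ ‖X ω‖) => ?_
        change Real.exp τ / 2 ≤ Real.cosh ‖X ω‖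
        rw [Real.cosh_eq]
        linarith [Real.exp_le_exp.2 hω, Real.exp_pos (-‖X ω‖)]
    _ = 2 * Real.exp (-τ) * (Real.exp τ / 2 * P.real {ω | Real.exp τ / 2 ≤ Real.cosh ‖X ω‖}) := by
        rw [Real.exp_neg]
        field_simp
    _ ≤ 2 * Real.exp (-τ) * ∫ ω, Real.cosh ‖X ω‖ ∂P := by gcongr

theorem integrable_cosh_norm {E : Type*} [NormedAddCommGroup E] [MeasurableSpace E]
    [OpensMeasurableSpace E] [SecondCountableTopology E] {Ω : Type*} [MeasurableSpace Ω]
    {P : Measure Ω} [IsFiniteMeasure P] {X : Ω → E} (hX : AEMeasurable X P) {c : ℝ}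
    (hXc : ∀ᵐ ω ∂P, ‖X ω‖ ≤ c) : Integrable (fun ω => Real.cosh ‖X ω‖) P := by
  refine Integrable.of_bound
    (Real.continuous_cosh.comp_aestronglyMeasurable hX.aestronglyMeasurable.norm) (Real.cosh c) ?_
  filter_upwards [hXc] with ω hω
  rw [Real.norm_of_nonneg (Real.cosh_pos _).le, Real.cosh_le_cosh, abs_norm]
  exact hω.trans (le_abs_self c)

variable {E : Type*} [NormedAddCommGroup E] [InnerProductSpace ℝ E]

theorem cosh_norm_add_le (s y : E) {c : ℝ} (hy : ‖y‖ ≤ c) :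
    Real.cosh ‖s + y‖ ≤ Real.cosh ‖s‖ * Real.cosh c +
      Real.sinh ‖s‖ * Real.sinh c / (‖s‖ * c) * inner ℝ s y := by
  have hc : 0 ≤ c := (norm_nonneg y).trans hy
  rcases eq_or_ne s 0 with rfl | hs
  · simpa [abs_of_nonneg hc] using hy
  rcases hc.eq_or_lt with rfl | hc
  · simp [norm_le_zero_iff.1 hy]
  set a := ‖s‖
  set β := inner ℝ s y
  have hac : 0 < a * c := mul_pos (norm_pos_iff.2 hs) hc
  have hβ : |β / (a * c)| ≤ 1 := by
    rw [abs_div, abs_of_pos hac, div_le_one hac]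
    exact (abs_real_inner_le_norm s y).trans (mul_le_mul_of_nonneg_left hy (norm_nonneg s))
  -- `‖s + y‖² ≤ a² + 2β + c²`, and the bound is a convex combination of `(a + c)²` and `(a - c)²`.
  set θ := (1 + β / (a * c)) / 2
  have hθ : θ * (a + c) ^ 2 + (1 - θ) * (a - c) ^ 2 = a ^ 2 + 2 * β + c ^ 2 := by
    have ha : a ≠ 0 := norm_ne_zero_iff.2 hs
    simp only [θ]
    field_simp
    ring
  have hθ0 : 0 ≤ θ := by simp only [θ]; linarith [(abs_le.1 hβ).1]
  have hθ1 : 0 ≤ 1 - θ := by simp only [θ]; linarith [(abs_le.1 hβ).2]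
  have hconv := convexOn_cosh_sqrt.2 (Set.mem_Ici.2 (sq_nonneg (a + c)))
    (Set.mem_Ici.2 (sq_nonneg (a - c))) hθ0 hθ1 (by ring)
  simp only [smul_eq_mul, Real.sqrt_sq_eq_abs, Real.cosh_abs, hθ] at hconv
  calc Real.cosh ‖s + y‖
      ≤ Real.cosh √(a ^ 2 + 2 * β + c ^ 2) := by
        rw [Real.cosh_le_cosh, abs_of_nonneg (norm_nonneg _), abs_of_nonneg (Real.sqrt_nonneg _)]
        refine Real.le_sqrt_of_sq_le ?_
        rw [norm_add_sq_real]
        gcongr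
    _ ≤ θ * Real.cosh (a + c) + (1 - θ) * Real.cosh (a - c) := hconv
    _ = Real.cosh a * Real.cosh c + Real.sinh a * Real.sinh c / (a * c) * β := by
        rw [Real.cosh_add, Real.cosh_sub]
        simp only [θ]
        ring

variable [CompleteSpace E] [MeasurableSpace E] [BorelSpace E] [SecondCountableTopology E]
  {Ω : Type*} [MeasurableSpace Ω] {P : Measure Ω} [IsProbabilityMeasure P]

theorem integral_cosh_norm_add_le {S X : Ω → E} (hSX : S ⟂ᵢ[P] X) (hS : AEMeasurable S P)
    (hX : AEMeasurable X P) {B c : ℝ} (hSB : ∀ᵐ ω ∂P, ‖S ω‖ ≤ B) (hXc : ∀ᵐ ω ∂P, ‖X ω‖ ≤ c)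
    (hX0 : ∫ ω, X ω ∂P = 0) :
    ∫ ω, Real.cosh ‖S ω + X ω‖ ∂P ≤ Real.exp (c ^ 2 / 2) * ∫ ω, Real.cosh ‖S ω‖ ∂P := by
  set g : E → E := fun s => (Real.sinh ‖s‖ * Real.sinh c / (‖s‖ * c)) • s with hg
  have hgm : Measurable g := by fun_prop
  have hg_norm (s : E) : ‖g s‖ ≤ Real.sinh ‖s‖ * |Real.sinh c / c| := by
    rcases eq_or_ne s 0 with rfl | hs
    · simp [hg]
    · rw [hg, norm_smul, Real.norm_eq_abs, mul_div_mul_comm, abs_mul,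
        abs_of_nonneg (div_nonneg (Real.sinh_nonneg_iff.2 (norm_nonneg s)) (norm_nonneg s)),
        mul_right_comm, div_mul_cancel₀ _ (norm_ne_zero_iff.2 hs)]
  have hgS : Integrable (fun ω => g (S ω)) P := by
    refine Integrable.of_bound (hgm.comp_aemeasurable hS).aestronglyMeasurable
      (Real.sinh B * |Real.sinh c / c|) ?_
    filter_upwards [hSB] with ω hω
    exact (hg_norm _).trans (by gcongr; exact Real.sinh_le_sinh.2 hω)
  have hXi : Integrable X P := Integrable.of_bound hX.aestronglyMeasurable c hXc
  have hgSX : IndepFun (fun ω => g (S ω)) X P := hSX.comp hgm measurable_id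
  have hinner : Integrable (fun ω => inner ℝ (g (S ω)) (X ω)) P :=
    hgSX.integrable_bilin hgS hXi (innerSL ℝ)
  have hinner_zero : ∫ ω, inner ℝ (g (S ω)) (X ω) ∂P = 0 :=
    (hgSX.integral_bilin hgS hXi (innerSL ℝ)).trans (by rw [hX0, map_zero])
  have hSi := integrable_cosh_norm hS hSB
  calc ∫ ω, Real.cosh ‖S ω + X ω‖ ∂P
      ≤ ∫ ω, (Real.cosh ‖S ω‖ * Real.cosh c + inner ℝ (g (S ω)) (X ω)) ∂P := by
        refine integral_mono_ae (integrable_cosh_norm (hS.add hX) (c := B + c) ?_)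
          ((hSi.mul_const _).add hinner) ?_
        · filter_upwards [hSB, hXc] with ω h₁ h₂ using norm_add_le_of_le h₁ h₂
        · filter_upwards [hXc] with ω hω
          simpa only [hg, real_inner_smul_left] using cosh_norm_add_le (S ω) (X ω) hω
    _ = Real.cosh c * ∫ ω, Real.cosh ‖S ω‖ ∂P := by
        rw [integral_add (hSi.mul_const _) hinner, hinner_zero, add_zero,
          integral_mul_const, mul_comm]
    _ ≤ Real.exp (c ^ 2 / 2) * ∫ ω, Real.cosh ‖S ω‖ ∂P := by
        gcongr
        exact Real.cosh_le_exp_half_sq c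

variable {ι : Type*} {X : ι → Ω → E} {c : ι → ℝ}

theorem integral_cosh_norm_sum_le (hX : iIndepFun X P) (hXm : ∀ i, AEMeasurable (X i) P)
    (hXc : ∀ i, ∀ᵐ ω ∂P, ‖X i ω‖ ≤ c i) (hX0 : ∀ i, ∫ ω, X i ω ∂P = 0) (s : Finset ι) :
    ∫ ω, Real.cosh ‖∑ i ∈ s, X i ω‖ ∂P ≤ Real.exp ((∑ i ∈ s, c i ^ 2) / 2) := by
  classical
  induction s using Finset.induction_on with
  | empty => simp
  | insert i s hi ih =>
    have hsum : ∀ᵐ ω ∂P, ‖∑ j ∈ s, X j ω‖ ≤ ∑ j ∈ s, c j := by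
      filter_upwards [(ae_ball_iff s.countable_toSet).2 fun j _ => hXc j] with ω hω
      exact norm_sum_le_of_le s hω
    have hindep : IndepFun (fun ω => ∑ j ∈ s, X j ω) (X i) P := by
      simpa only [Finset.sum_fn] using hX.indepFun_finsetSum_of_notMem₀ hXm hi
    calc ∫ ω, Real.cosh ‖∑ j ∈ insert i s, X j ω‖ ∂P
        = ∫ ω, Real.cosh ‖∑ j ∈ s, X j ω + X i ω‖ ∂P := by
          simp only [Finset.sum_insert hi, add_comm]
      _ ≤ Real.exp (c i ^ 2 / 2) * ∫ ω, Real.cosh ‖∑ j ∈ s, X j ω‖ ∂P :=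
          integral_cosh_norm_add_le hindep (s.aemeasurable_fun_sum fun j _ => hXm j) (hXm i) hsum
            (hXc i) (hX0 i)
      _ ≤ Real.exp (c i ^ 2 / 2) * Real.exp ((∑ j ∈ s, c j ^ 2) / 2) := by gcongr
      _ = Real.exp ((∑ j ∈ insert i s, c j ^ 2) / 2) := by
          rw [← Real.exp_add, Finset.sum_insert hi, add_div]

/-- Pinelis' dimension-free Hoeffding inequality. -/
theorem measureReal_norm_sum_ge_le_of_iIndepFun [Fintype ι] (hX : iIndepFun X P)
    (hXm : ∀ i, AEMeasurable (X i) P) (hXc : ∀ i, ∀ᵐ ω ∂P, ‖X i ω‖ ≤ c i)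
    (hX0 : ∀ i, ∫ ω, X i ω ∂P = 0) {τ : ℝ} (hτ : 0 ≤ τ) :
    P.real {ω | τ ≤ ‖∑ i, X i ω‖} ≤ 2 * Real.exp (-τ ^ 2 / (2 * ∑ i, c i ^ 2)) := by
  set V := ∑ i, c i ^ 2
  rcases (Finset.sum_nonneg fun i _ => sq_nonneg (c i) : 0 ≤ V).eq_or_lt with hV | hV
  · simpa [V, ← hV] using measureReal_le_one.trans one_le_two
  -- The exponent `l ^ 2 * V / 2 - l * τ` of Chernoff's method is minimal at `l = τ / V`.
  set l := τ / V
  have hl : 0 ≤ l := by positivity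
  have hlXc (i : ι) : ∀ᵐ ω ∂P, ‖l • X i ω‖ ≤ l * c i := by
    filter_upwards [hXc i] with ω hω
    rw [norm_smul, Real.norm_of_nonneg hl]
    gcongr
  have hlXm (i : ι) : AEMeasurable (fun ω => l • X i ω) P := (hXm i).const_smul l
  have hint : Integrable (fun ω => Real.cosh ‖∑ i, l • X i ω‖) P := by
    refine integrable_cosh_norm (Finset.univ.aemeasurable_fun_sum fun i _ => hlXm i)
      (c := ∑ i, l * c i) ?_
    filter_upwards [ae_all_iff.2 hlXc] with ω hω using norm_sum_le_of_le _ fun i _ => hω i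
  calc P.real {ω | τ ≤ ‖∑ i, X i ω‖}
      ≤ P.real {ω | l * τ ≤ ‖∑ i, l • X i ω‖} := by
        refine measureReal_mono fun ω (hω : τ ≤ _) => ?_
        change l * τ ≤ ‖∑ i, l • X i ω‖
        rw [← Finset.smul_sum, norm_smul, Real.norm_of_nonneg hl]
        gcongr
    _ ≤ 2 * Real.exp (-(l * τ)) * ∫ ω, Real.cosh ‖∑ i, l • X i ω‖ ∂P :=
        measureReal_norm_ge_le_integral_cosh hint _
    _ ≤ 2 * Real.exp (-(l * τ)) * Real.exp ((∑ i, (l * c i) ^ 2) / 2) := by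
        gcongr
        exact integral_cosh_norm_sum_le (hX.comp _ fun _ => measurable_const_smul l) hlXm hlXc
          (fun i => (integral_smul l _).trans (by rw [hX0 i, smul_zero])) Finset.univ
    _ = 2 * Real.exp (-τ ^ 2 / (2 * V)) := by
        have hVl : ∑ i, (l * c i) ^ 2 = l ^ 2 * V := by simp only [mul_pow, Finset.mul_sum, V]
        rw [hVl, mul_assoc, ← Real.exp_add]
        congr 2
        simp only [l]
        field_simp
        ring

theorem measureReal_norm_average_sub_ge_le [Fintype ι] [Nonempty ι] (hX : iIndepFun X P)
    (hXm : ∀ i, AEMeasurable (X i) P) {M : ℝ} (hM : 0 < M) (hXM : ∀ i, ∀ᵐ ω ∂P, ‖X i ω‖ ≤ M)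
    {μ : E} (hμ : ∀ i, ∫ ω, X i ω ∂P = μ) {l : ℝ} (hl : 0 ≤ l) :
    P.real {ω | M * √(8 * l / Fintype.card ι) ≤ ‖(Fintype.card ι : ℝ)⁻¹ • ∑ i, X i ω - μ‖} ≤
      2 * Real.exp (-l) := by
  set k := (Fintype.card ι : ℝ) with hk
  have hk0 : 0 < k := by positivity
  have hXi (i : ι) : Integrable (X i) P := .of_bound (hXm i).aestronglyMeasurable M (hXM i)
  have hbound (i : ι) : ∀ᵐ ω ∂P, ‖X i ω - μ‖ ≤ 2 * M := by
    have hμM : ‖μ‖ ≤ M := by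
      simpa [hμ i] using norm_integral_le_of_norm_le_const (hXM i)
    filter_upwards [hXM i] with ω hω
    linarith [norm_sub_le (X i ω) μ]
  have hcentred (i : ι) : ∫ ω, (X i ω - μ) ∂P = 0 := by
    rw [integral_sub (hXi i) (integrable_const μ), hμ i]
    simp
  have hsum (ω : Ω) : ‖∑ i, (X i ω - μ)‖ = k * ‖k⁻¹ • ∑ i, X i ω - μ‖ := by
    rw [← Real.norm_of_nonneg hk0.le, ← norm_smul, smul_sub, Real.norm_of_nonneg hk0.le,
      smul_inv_smul₀ hk0.ne', Finset.sum_sub_distrib, Finset.sum_const, Finset.card_univ, hk,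
      Nat.cast_smul_eq_nsmul]
  calc P.real {ω | M * √(8 * l / k) ≤ ‖k⁻¹ • ∑ i, X i ω - μ‖}
      ≤ P.real {ω | k * (M * √(8 * l / k)) ≤ ‖∑ i, (X i ω - μ)‖} := by
        refine measureReal_mono fun ω (hω : _ ≤ ‖_‖) => ?_
        change _ ≤ ‖∑ i, (X i ω - μ)‖
        rw [hsum]
        gcongr
    _ ≤ 2 * Real.exp (-(k * (M * √(8 * l / k))) ^ 2 / (2 * ∑ _i : ι, (2 * M) ^ 2)) :=
        measureReal_norm_sum_ge_le_of_iIndepFun (hX.comp _ fun _ => measurable_sub_const μ)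
          (fun i => (hXm i).sub_const μ) hbound hcentred (by positivity)
    _ = 2 * Real.exp (-l) := by
        rw [Finset.sum_const, Finset.card_univ, nsmul_eq_mul, ← hk, mul_pow, mul_pow,
          Real.sq_sqrt (by positivity)]
        congr 2
        field_simp
        ring

end VectorHoeffding

theorem measureReal_average_ge_le {Ω : Type*} [MeasurableSpace Ω] {P : Measure Ω}
    [IsProbabilityMeasure P] {ι : Type*} [Fintype ι] [Nonempty ι] {X : ι → Ω → ℝ}
    (hX : iIndepFun X P) (hXm : ∀ i, AEMeasurable (X i) P) {M : ℝ} (hM : 0 < M)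
    (hXM : ∀ i, ∀ᵐ ω ∂P, X i ω ∈ Set.Icc 0 M) {μ : ℝ} (hμ : ∀ i, ∫ ω, X i ω ∂P = μ) {l : ℝ}
    (hl : 0 ≤ l) :
    P.real {ω | μ + M * √(l / (2 * Fintype.card ι)) ≤ (Fintype.card ι : ℝ)⁻¹ * ∑ i, X i ω} ≤
      Real.exp (-l) := by
  set k := (Fintype.card ι : ℝ) with hk
  have hk0 : 0 < k := by positivity
  have hsub (i : ι) : HasSubgaussianMGF (fun ω => X i ω - μ) ((‖M - 0‖₊ / 2) ^ 2) P := by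
    simpa only [hμ i] using hasSubgaussianMGF_of_mem_Icc (hXm i) (hXM i)
  calc P.real {ω | μ + M * √(l / (2 * k)) ≤ k⁻¹ * ∑ i, X i ω}
      ≤ P.real {ω | k * (M * √(l / (2 * k))) ≤ ∑ i, (X i ω - μ)} := by
        refine measureReal_mono fun ω (hω : μ + _ ≤ _) => ?_
        change _ ≤ ∑ i, (X i ω - μ)
        rw [Finset.sum_sub_distrib, Finset.sum_const, Finset.card_univ, nsmul_eq_mul, ← hk]
        rw [le_inv_mul_iff₀ hk0] at hω
        linarith
    _ ≤ Real.exp (-(k * (M * √(l / (2 * k)))) ^ 2 /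
          (2 * ((∑ _i : ι, (‖M - 0‖₊ / 2) ^ 2 : ℝ≥0) : ℝ))) :=
        HasSubgaussianMGF.measure_sum_ge_le_of_iIndepFun
          (hX.comp _ fun _ => measurable_sub_const μ) (fun i _ => hsub i) (by positivity)
    _ = Real.exp (-l) := by
        rw [Finset.sum_const, Finset.card_univ, nsmul_eq_mul, mul_pow, mul_pow,
          Real.sq_sqrt (by positivity)]
        congr 1
        push_cast
        rw [← hk, sub_zero, Real.norm_of_nonneg hM.le]
        field_simp

section FrobeniusNorm

variable {l m n : Type*} [Fintype l] [Fintype m] [Fintype n]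

theorem frobenius_norm_sq (M : Matrix m n ℂ) : ‖M‖ ^ 2 = ∑ i, ∑ j, ‖M i j‖ ^ 2 := by
  rw [Matrix.frobenius_norm_def, ← Real.sqrt_eq_rpow, Real.sq_sqrt (by positivity)]
  simp only [Real.rpow_two]

theorem frobenius_norm_sq_eq_trace (M : Matrix m n ℂ) : ((‖M‖ ^ 2 : ℝ) : ℂ) = (Mᴴ * M).trace := by
  rw [frobenius_norm_sq, Finset.sum_comm]
  simp [Matrix.trace, Matrix.mul_apply, Complex.conj_mul']

theorem frobenius_norm_mul_left [DecidableEq m] {U : Matrix l m ℂ} (hU : Uᴴ * U = 1)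
    (M : Matrix m n ℂ) : ‖U * M‖ = ‖M‖ := by
  refine (sq_eq_sq₀ (norm_nonneg _) (norm_nonneg _)).1 (Complex.ofReal_injective ?_)
  rw [frobenius_norm_sq_eq_trace, frobenius_norm_sq_eq_trace, Matrix.conjTranspose_mul,
    Matrix.mul_assoc, ← Matrix.mul_assoc Uᴴ, hU, Matrix.one_mul]

theorem frobenius_norm_mul_right [DecidableEq m] {V : Matrix m l ℂ} (hV : V * Vᴴ = 1)
    (M : Matrix n m ℂ) : ‖M * V‖ = ‖M‖ := by
  rw [← Matrix.frobenius_norm_conjTranspose, Matrix.conjTranspose_mul,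
    frobenius_norm_mul_left (by rwa [Matrix.conjTranspose_conjTranspose]),
    Matrix.frobenius_norm_conjTranspose]

theorem frobenius_norm_le_of_entry_le {M N : Matrix m n ℂ} {K : ℝ} (hK : 0 ≤ K)
    (h : ∀ i j, ‖M i j‖ ≤ K * ‖N i j‖) : ‖M‖ ≤ K * ‖N‖ := by
  refine (sq_le_sq₀ (norm_nonneg _) (by positivity)).1 ?_
  simp only [mul_pow, frobenius_norm_sq, Finset.mul_sum]
  gcongr with i _ j _
  rw [← mul_pow]
  exact pow_le_pow_left₀ (norm_nonneg _) (h i j) 2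

theorem sum_norm_sq_mulVec_le (M : Matrix m n ℂ) (w : n → ℂ) :
    ∑ i, ‖(M *ᵥ w) i‖ ^ 2 ≤ ‖M‖ ^ 2 * ∑ j, ‖w j‖ ^ 2 := by
  have h := pow_le_pow_left₀ (norm_nonneg _)
    (Matrix.frobenius_norm_mul M (Matrix.replicateCol Unit w)) 2
  rw [mul_pow, ← Matrix.replicateCol_mulVec, frobenius_norm_sq (Matrix.replicateCol _ _),
    frobenius_norm_sq (Matrix.replicateCol _ _)] at h
  simpa only [Matrix.replicateCol_apply, Finset.univ_unique, Finset.sum_singleton] using h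

/-- Matrices with the Frobenius norm as a Euclidean space, so that Hilbert space inequalities apply
to them. -/
noncomputable def frobeniusIsometry (m n : ℕ) :
    Matrix (Fin m) (Fin n) ℂ →ₗᵢ[ℝ] EuclideanSpace ℂ (Fin m × Fin n) where
  toFun B := WithLp.toLp 2 fun x => B x.1 x.2
  map_add' _ _ := rfl
  map_smul' _ _ := rfl
  norm_map' B := by
    refine (sq_eq_sq₀ (norm_nonneg _) (norm_nonneg _)).1 ?_
    rw [frobenius_norm_sq, EuclideanSpace.norm_sq_eq, Fintype.sum_prod_type]
    rfl

end FrobeniusNorm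

section SingularValueTransformation

open Matrix

variable {n k : ℕ} {H : Matrix (Fin n) (Fin n) ℂ} {G : Matrix (Fin k) (Fin k) ℂ}

/-- The eigenvalues of a positive semidefinite matrix as elements of `ℝ≥0`, the domain of the
functions that a singular value transformation applies to them. -/
noncomputable def nnEigenvalues (hH : H.PosSemidef) (i : Fin n) : ℝ≥0 :=
  ⟨hH.isHermitian.eigenvalues i, hH.eigenvalues_nonneg i⟩

/-- The matrix whose columns are the orthonormal eigenvectors that
`singularValueTransformation` uses. -/
noncomputable def eigenmatrix (hH : H.PosSemidef) : Matrix (Fin n) (Fin n) ℂ :=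
  hH.isHermitian.eigenvectorUnitary

theorem conjTranspose_mul_eigenmatrix (hH : H.PosSemidef) :
    (eigenmatrix hH)ᴴ * eigenmatrix hH = 1 :=
  Unitary.coe_star_mul_self _

theorem eigenmatrix_mul_conjTranspose (hH : H.PosSemidef) :
    eigenmatrix hH * (eigenmatrix hH)ᴴ = 1 :=
  Unitary.coe_mul_star_self _

theorem frobenius_norm_eigenmatrix_conj (hH : H.PosSemidef) (hG : G.PosSemidef)
    (M : Matrix (Fin n) (Fin k) ℂ) : ‖eigenmatrix hH * M * (eigenmatrix hG)ᴴ‖ = ‖M‖ := by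
  rw [frobenius_norm_mul_right, frobenius_norm_mul_left (conjTranspose_mul_eigenmatrix hH)]
  rw [conjTranspose_conjTranspose, conjTranspose_mul_eigenmatrix hG]

theorem eigenmatrix_conj_conjTranspose_conj (hH : H.PosSemidef) (hG : G.PosSemidef)
    (M : Matrix (Fin n) (Fin k) ℂ) :
    eigenmatrix hH * ((eigenmatrix hH)ᴴ * M * eigenmatrix hG) * (eigenmatrix hG)ᴴ = M := by
  rw [← Matrix.mul_assoc, ← Matrix.mul_assoc, eigenmatrix_mul_conjTranspose hH, Matrix.one_mul,
    Matrix.mul_assoc, eigenmatrix_mul_conjTranspose hG, Matrix.mul_one]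

theorem singularValueTransformation_eq (f : ℝ≥0 → ℂ) (hH : H.PosSemidef) :
    singularValueTransformation f hH =
      eigenmatrix hH * diagonal (fun i => f (nnEigenvalues hH i)) * (eigenmatrix hH)ᴴ := by
  ext a b
  simp only [singularValueTransformation, mul_apply (M := _ * _), Matrix.sum_apply,
    Matrix.smul_apply, vecMulVec_apply, mul_diagonal, conjTranspose_apply, Pi.star_apply,
    smul_eq_mul, eigenmatrix, IsHermitian.eigenvectorUnitary_apply, nnEigenvalues]
  exact Finset.sum_congr rfl fun i _ => by ring

theorem singularValueTransformation_ofReal (hH : H.PosSemidef) :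
    singularValueTransformation (fun x => ((x : ℝ) : ℂ)) hH = H := by
  rw [singularValueTransformation_eq]
  conv_rhs => rw [hH.isHermitian.spectral_theorem, Unitary.conjStarAlgAut_apply]
  rfl

theorem singularValueTransformation_mul (f g : ℝ≥0 → ℂ) (hH : H.PosSemidef) :
    singularValueTransformation (fun x => f x * g x) hH =
      singularValueTransformation f hH * singularValueTransformation g hH := by
  simp only [singularValueTransformation_eq]
  rw [← diagonal_mul_diagonal]
  simp only [Matrix.mul_assoc]
  rw [← Matrix.mul_assoc (eigenmatrix hH)ᴴ, conjTranspose_mul_eigenmatrix, Matrix.one_mul]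

theorem conjTranspose_eigenmatrix_mul_sub_mul_apply (f g : ℝ≥0 → ℂ) (hH : H.PosSemidef)
    (hG : G.PosSemidef) (M : Matrix (Fin n) (Fin k) ℂ) (i : Fin n) (j : Fin k) :
    ((eigenmatrix hH)ᴴ * (singularValueTransformation f hH * M -
        M * singularValueTransformation g hG) * eigenmatrix hG) i j =
      (f (nnEigenvalues hH i) - g (nnEigenvalues hG j)) *
        ((eigenmatrix hH)ᴴ * M * eigenmatrix hG) i j := by
  have hfM : (eigenmatrix hH)ᴴ * (singularValueTransformation f hH * M) * eigenmatrix hG =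
      diagonal (fun i => f (nnEigenvalues hH i)) * ((eigenmatrix hH)ᴴ * M * eigenmatrix hG) := by
    rw [singularValueTransformation_eq]
    simp only [← Matrix.mul_assoc, conjTranspose_mul_eigenmatrix, Matrix.one_mul]
  have hMg : (eigenmatrix hH)ᴴ * (M * singularValueTransformation g hG) * eigenmatrix hG =
      (eigenmatrix hH)ᴴ * M * eigenmatrix hG * diagonal (fun j => g (nnEigenvalues hG j)) := by
    rw [singularValueTransformation_eq]
    simp only [Matrix.mul_assoc, conjTranspose_mul_eigenmatrix, Matrix.mul_one]
  rw [Matrix.mul_sub, Matrix.sub_mul, hfM, hMg, Matrix.sub_apply, diagonal_mul, mul_diagonal]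
  ring

theorem singularValueTransformation_mul_eq_mul (f : ℝ≥0 → ℂ) (hH : H.PosSemidef)
    (hG : G.PosSemidef) {M : Matrix (Fin n) (Fin k) ℂ} (hM : H * M = M * G) :
    singularValueTransformation f hH * M = M * singularValueTransformation f hG := by
  suffices h : (eigenmatrix hH)ᴴ * (singularValueTransformation f hH * M -
      M * singularValueTransformation f hG) * eigenmatrix hG = 0 by
    rw [← sub_eq_zero, ← eigenmatrix_conj_conjTranspose_conj hH hG (_ - _), h, Matrix.mul_zero,
      Matrix.zero_mul]
  ext i j
  have h := conjTranspose_eigenmatrix_mul_sub_mul_apply (fun x => ((x : ℝ) : ℂ))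
    (fun x => ((x : ℝ) : ℂ)) hH hG M i j
  rw [singularValueTransformation_ofReal, singularValueTransformation_ofReal, hM, sub_self,
    Matrix.mul_zero, Matrix.zero_mul, Matrix.zero_apply, zero_eq_mul, sub_eq_zero] at h
  rw [conjTranspose_eigenmatrix_mul_sub_mul_apply, Matrix.zero_apply]
  rcases h with h | h
  · rw [NNReal.coe_injective (Complex.ofReal_injective h), sub_self, zero_mul]
  · rw [h, mul_zero]

theorem conjTranspose_mul_singularValueTransformation_mul {f g : ℝ≥0 → ℂ}
    (hfg : ∀ x : ℝ≥0, f x = ((x : ℝ) : ℂ) * g x) (R : Matrix (Fin k) (Fin n) ℂ) :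
    Rᴴ * singularValueTransformation g (posSemidef_self_mul_conjTranspose R) * R =
      singularValueTransformation f (posSemidef_conjTranspose_mul_self R) := by
  rw [Matrix.mul_assoc, singularValueTransformation_mul_eq_mul g _
    (posSemidef_conjTranspose_mul_self R) (Matrix.mul_assoc R Rᴴ R), ← Matrix.mul_assoc, funext hfg,
    singularValueTransformation_mul, singularValueTransformation_ofReal]

theorem mul_fbar {f : ℝ≥0 → ℂ} (hf : f 0 = 0) (x : ℝ≥0) : f x = ((x : ℝ) : ℂ) * fbar f x := by
  rcases eq_or_ne x 0 with rfl | hx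
  · simp [hf]
  · have hx' : ((x : ℝ) : ℂ) ≠ 0 := by exact_mod_cast hx
    rw [fbar, if_neg hx, mul_div_cancel₀ _ hx']

end SingularValueTransformation

section Perturbation

open Matrix

variable {l n k : ℕ} {H G : Matrix (Fin n) (Fin n) ℂ}

/-- The eigenvalues of `H` that have an eigenvector outside the kernel of `P`. The product of `P`
with a singular value transformation of `H` only involves the function at these points. -/
def visibleEigenvalues (P : Matrix (Fin l) (Fin n) ℂ) (H : Matrix (Fin n) (Fin n) ℂ) : Set ℝ≥0 :=
  {x | ∃ v, H *ᵥ v = ((x : ℝ) : ℂ) • v ∧ P *ᵥ v ≠ 0}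

/-- The diagonal `0`-`1` matrix that selects the nonzero columns of `A`. -/
noncomputable def colSupport (A : Matrix (Fin l) (Fin n) ℂ) : Matrix (Fin n) (Fin n) ℂ :=
  open Classical in diagonal fun i => if A.col i = 0 then 0 else 1

theorem mul_colSupport (A : Matrix (Fin l) (Fin n) ℂ) : A * colSupport A = A := by
  ext i j
  rw [colSupport, mul_diagonal]
  split_ifs with h
  · rw [mul_zero]
    exact (congrFun h i).symm
  · rw [mul_one]

theorem colSupport_mul_conjTranspose (A : Matrix (Fin l) (Fin n) ℂ) :
    colSupport A * Aᴴ = Aᴴ := by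
  have hD : (colSupport A)ᴴ = colSupport A := by
    rw [colSupport, diagonal_conjTranspose]
    congr 1
    ext i
    rw [Pi.star_apply, apply_ite star, star_zero, star_one]
  rw [← hD, ← conjTranspose_mul, mul_colSupport]

theorem mulVec_col_eigenmatrix (hH : H.PosSemidef) (i : Fin n) :
    H *ᵥ (eigenmatrix hH).col i = ((nnEigenvalues hH i : ℝ) : ℂ) • (eigenmatrix hH).col i :=
  hH.isHermitian.mulVec_eigenvectorBasis i

theorem nnEigenvalues_mem_visibleEigenvalues (hH : H.PosSemidef) {P : Matrix (Fin l) (Fin n) ℂ}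
    {i : Fin n} (hi : (P * eigenmatrix hH).col i ≠ 0) :
    nnEigenvalues hH i ∈ visibleEigenvalues P H :=
  ⟨_, mulVec_col_eigenmatrix hH i, hi⟩

theorem norm_conjTranspose_eigenmatrix_mul_sub_mul_apply_le (hH : H.PosSemidef)
    (hG : G.PosSemidef) {f : ℝ≥0 → ℂ} {K : ℝ} {i j : Fin n}
    (hf : ‖f (nnEigenvalues hH i) - f (nnEigenvalues hG j)‖ ≤
      K * |(nnEigenvalues hH i : ℝ) - nnEigenvalues hG j|) :
    ‖((eigenmatrix hH)ᴴ * (singularValueTransformation f hH - singularValueTransformation f hG) *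
        eigenmatrix hG) i j‖ ≤
      K * ‖((eigenmatrix hH)ᴴ * (H - G) * eigenmatrix hG) i j‖ := by
  have hsub (g : ℝ≥0 → ℂ) := conjTranspose_eigenmatrix_mul_sub_mul_apply g g hH hG 1 i j
  simp only [Matrix.mul_one, Matrix.one_mul] at hsub
  have hid := hsub fun x => ((x : ℝ) : ℂ)
  rw [singularValueTransformation_ofReal, singularValueTransformation_ofReal] at hid
  rw [hsub, hid, norm_mul, norm_mul, ← mul_assoc, ← Complex.ofReal_sub, Complex.norm_real]
  gcongr
  exact hf

/- In eigenbases of `H` and `G` the entries of `f(H) - f(G)` are those of `H - G` multiplied by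
divided differences of `f`; `N` keeps only the entries at visible eigenvalues. -/
theorem exists_norm_le_and_mul_sub_mul_eq (hH : H.PosSemidef) (hG : G.PosSemidef)
    {P : Matrix (Fin l) (Fin n) ℂ} {Q : Matrix (Fin n) (Fin k) ℂ} {f : ℝ≥0 → ℂ} {K : ℝ}
    (hK : 0 ≤ K) (hf : ∀ x ∈ visibleEigenvalues P H, ∀ y ∈ visibleEigenvalues Qᴴ G,
      ‖f x - f y‖ ≤ K * |(x : ℝ) - y|) :
    ∃ N : Matrix (Fin n) (Fin n) ℂ, ‖N‖ ≤ K * ‖H - G‖ ∧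
      P * (singularValueTransformation f hH - singularValueTransformation f hG) * Q =
        P * N * Q := by
  let U := eigenmatrix hH
  let V := eigenmatrix hG
  let Δ := singularValueTransformation f hH - singularValueTransformation f hG
  let D := colSupport (P * U)
  let D' := colSupport (Qᴴ * V)
  refine ⟨U * (D * (Uᴴ * Δ * V) * D') * Vᴴ, ?_, ?_⟩
  · rw [frobenius_norm_eigenmatrix_conj, ← eigenmatrix_conj_conjTranspose_conj hH hG (H - G),
      frobenius_norm_eigenmatrix_conj]
    refine frobenius_norm_le_of_entry_le hK fun i j => ?_
    have hnonneg : 0 ≤ K * ‖(Uᴴ * (H - G) * V) i j‖ := by positivity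
    simp only [D, D', colSupport, diagonal_mul, mul_diagonal]
    split_ifs with hi hj hj
    · simpa only [zero_mul, norm_zero] using hnonneg
    · simpa only [zero_mul, norm_zero] using hnonneg
    · simpa only [mul_zero, norm_zero] using hnonneg
    · rw [one_mul, mul_one]
      exact norm_conjTranspose_eigenmatrix_mul_sub_mul_apply_le hH hG <|
        hf _ (nnEigenvalues_mem_visibleEigenvalues hH hi) _
          (nnEigenvalues_mem_visibleEigenvalues hG hj)
  · have hPU : P * U * D = P * U := mul_colSupport _
    have hVQ : D' * (Vᴴ * Q) = Vᴴ * Q := by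
      simpa only [conjTranspose_mul, conjTranspose_conjTranspose] using
        colSupport_mul_conjTranspose (Qᴴ * V)
    calc P * Δ * Q = P * (U * (Uᴴ * Δ * V) * Vᴴ) * Q := by
          rw [eigenmatrix_conj_conjTranspose_conj]
      _ = P * U * (Uᴴ * Δ * V) * (Vᴴ * Q) := by simp only [Matrix.mul_assoc]
      _ = P * U * D * (Uᴴ * Δ * V) * (D' * (Vᴴ * Q)) := by rw [hPU, hVQ]
      _ = P * (U * (D * (Uᴴ * Δ * V) * D') * Vᴴ) * Q := by simp only [Matrix.mul_assoc]

theorem norm_singularValueTransformation_sub_le (hH : H.PosSemidef) (hG : G.PosSemidef)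
    {f : ℝ≥0 → ℂ} {K : ℝ} (hK : 0 ≤ K)
    (hf : ∀ x ∈ visibleEigenvalues (1 : Matrix (Fin n) (Fin n) ℂ) H,
      ∀ y ∈ visibleEigenvalues (1 : Matrix (Fin n) (Fin n) ℂ) G,
      ‖f x - f y‖ ≤ K * |(x : ℝ) - y|) :
    ‖singularValueTransformation f hH - singularValueTransformation f hG‖ ≤ K * ‖H - G‖ := by
  obtain ⟨N, hN, h⟩ := exists_norm_le_and_mul_sub_mul_eq hH hG (P := 1) (Q := 1) hK
    (by rwa [conjTranspose_one])
  rw [Matrix.one_mul, Matrix.mul_one, Matrix.one_mul, Matrix.mul_one] at h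
  rwa [h]

/- A weak form of Weyl's inequality that also locates the eigenvector of `H`: were `x` far from
all `λ_j` with `(Uᴴ q)_j ≠ 0`, then `(Z - H) q = (x - H) q` would be too long. -/
theorem exists_abs_sub_nnEigenvalues_le (hH : H.PosSemidef) (Z : Matrix (Fin n) (Fin n) ℂ)
    {q : Fin n → ℂ} (hq : q ≠ 0) {x : ℝ} (hx : Z *ᵥ q = (x : ℂ) • q) :
    ∃ j, ((eigenmatrix hH)ᴴ *ᵥ q) j ≠ 0 ∧ |x - nnEigenvalues hH j| ≤ ‖Z - H‖ := by
  set U := eigenmatrix hH with hU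
  set w := Uᴴ *ᵥ q with hw
  have hUw : U *ᵥ w = q := by
    rw [hw, mulVec_mulVec, eigenmatrix_mul_conjTranspose, one_mulVec]
  obtain ⟨j₀, hj₀⟩ : ∃ j, w j ≠ 0 :=
    Function.ne_iff.1 fun h => hq (by rw [← hUw, h]; exact mulVec_zero U)
  have hKw (j) : ((Uᴴ * (Z - H) * U) *ᵥ w) j = ((x - nnEigenvalues hH j : ℝ) : ℂ) * w j := by
    have hUH : Uᴴ * H = diagonal (fun i => ((nnEigenvalues hH i : ℝ) : ℂ)) * Uᴴ := by
      conv_lhs => rw [← singularValueTransformation_ofReal hH, singularValueTransformation_eq]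
      simp only [← Matrix.mul_assoc, hU, conjTranspose_mul_eigenmatrix, Matrix.one_mul]
    rw [← mulVec_mulVec, hUw, Matrix.mul_sub, sub_mulVec, ← mulVec_mulVec, hx, mulVec_smul, hUH,
      ← mulVec_mulVec, Pi.sub_apply, Pi.smul_apply, mulVec_diagonal, smul_eq_mul,
      Complex.ofReal_sub, sub_mul]
  by_contra! hfar
  refine (sum_norm_sq_mulVec_le (Uᴴ * (Z - H) * U) w).not_gt ?_
  rw [← frobenius_norm_eigenmatrix_conj hH hH (Uᴴ * _ * U), eigenmatrix_conj_conjTranspose_conj,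
    Finset.mul_sum]
  simp only [hKw, norm_mul, mul_pow, Complex.norm_real, Real.norm_eq_abs]
  refine Finset.sum_lt_sum (fun j _ => ?_) ⟨j₀, Finset.mem_univ _, ?_⟩
  · rcases eq_or_ne (w j) 0 with hj | hj
    · rw [hj, norm_zero, zero_pow two_ne_zero, mul_zero, mul_zero]
    · gcongr
      exact (hfar j hj).le
  · have := norm_pos_iff.2 hj₀
    gcongr
    exact hfar j₀ hj₀

theorem visibleEigenvalues_one_subset_specNhd (hH : H.PosSemidef)
    (Z : Matrix (Fin n) (Fin n) ℂ) {χ : ℝ} (hχ : ‖Z - H‖ ≤ χ) :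
    visibleEigenvalues (1 : Matrix (Fin n) (Fin n) ℂ) Z ⊆ specNhd χ hH := by
  rintro x ⟨v, hv, hv0⟩
  rw [one_mulVec] at hv0
  obtain ⟨j, -, hj⟩ := exists_abs_sub_nnEigenvalues_le hH Z hv0 hv
  exact ⟨_, ⟨j, rfl⟩, hj.trans hχ⟩

theorem mem_specNhd_of_abs_sub_le {hH : H.PosSemidef} {a χ : ℝ} {x y : ℝ≥0}
    (hy : y ∈ specNhd a hH) (hxy : a + |(x : ℝ) - y| ≤ χ) : x ∈ specNhd χ hH := by
  obtain ⟨z, hz, hyz⟩ := hy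
  exact ⟨z, hz, by linarith [abs_sub_le (x : ℝ) y z]⟩

theorem visibleEigenvalues_self_mul_conjTranspose_subset (R : Matrix (Fin k) (Fin n) ℂ) :
    visibleEigenvalues Rᴴ (R * Rᴴ) ⊆
      visibleEigenvalues (1 : Matrix (Fin n) (Fin n) ℂ) (Rᴴ * R) := by
  rintro x ⟨v, hv, hRv⟩
  refine ⟨Rᴴ *ᵥ v, ?_, by rwa [one_mulVec]⟩
  rw [mulVec_mulVec, Matrix.mul_assoc, ← mulVec_mulVec, hv, mulVec_smul]

/- The eigenvector `u` of `R * G * Rᴴ` is replaced by its projection `Q *ᵥ u` to the span of the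
visible eigenvectors of `R * Rᴴ`, which changes neither `Rᴴ *ᵥ u` nor the eigenvalue. -/
theorem exists_mem_visibleEigenvalues_abs_sub_le (R : Matrix (Fin k) (Fin n) ℂ) {x : ℝ≥0}
    (hx : x ∈ visibleEigenvalues Rᴴ (R * G * Rᴴ)) :
    ∃ y ∈ visibleEigenvalues Rᴴ (R * Rᴴ), |(x : ℝ) - y| ≤ ‖R * G * Rᴴ - R * Rᴴ‖ := by
  obtain ⟨u, hu, hRu⟩ := hx
  let hY := posSemidef_self_mul_conjTranspose R
  let U := eigenmatrix hY
  let D := colSupport (Rᴴ * U)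
  let Q := U * D * Uᴴ
  have hRQ : Rᴴ * Q = Rᴴ := by
    calc Rᴴ * Q = Rᴴ * U * D * Uᴴ := by simp only [Q, Matrix.mul_assoc]
      _ = Rᴴ := by
        rw [mul_colSupport, Matrix.mul_assoc, eigenmatrix_mul_conjTranspose, Matrix.mul_one]
  have hQR : Q * R = R := by
    have hDUR : D * (Uᴴ * R) = Uᴴ * R := by
      simpa only [conjTranspose_mul, conjTranspose_conjTranspose] using
        colSupport_mul_conjTranspose (Rᴴ * U)
    rw [Matrix.mul_assoc, Matrix.mul_assoc, hDUR, ← Matrix.mul_assoc,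
      eigenmatrix_mul_conjTranspose, Matrix.one_mul]
  have hQu : Rᴴ *ᵥ (Q *ᵥ u) = Rᴴ *ᵥ u := by rw [mulVec_mulVec, hRQ]
  have hXQu : (R * G * Rᴴ) *ᵥ (Q *ᵥ u) = ((x : ℝ) : ℂ) • (Q *ᵥ u) := by
    rw [← mulVec_smul, ← hu, mulVec_mulVec, mulVec_mulVec, Matrix.mul_assoc _ Rᴴ, hRQ,
      ← Matrix.mul_assoc Q, ← Matrix.mul_assoc Q, hQR]
  have hQu0 : Q *ᵥ u ≠ 0 := fun h => hRu (by rw [← hQu, h, mulVec_zero])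
  obtain ⟨j, hj, hxj⟩ := exists_abs_sub_nnEigenvalues_le hY _ hQu0 hXQu
  refine ⟨_, nnEigenvalues_mem_visibleEigenvalues hY fun hcol => hj ?_, hxj⟩
  have hUQ : Uᴴ * Q = D * Uᴴ := by
    simp only [Q, ← Matrix.mul_assoc, U, conjTranspose_mul_eigenmatrix, Matrix.one_mul]
  rw [mulVec_mulVec, hUQ, ← mulVec_mulVec]
  simp only [D, colSupport, mulVec_diagonal]
  rw [if_pos hcol, zero_mul]

variable {f : ℝ≥0 → ℂ} {L Lbar χ : ℝ}

theorem norm_singularValueTransformation_gram_sub_le (hL : 0 ≤ L) (hH : H.PosSemidef)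
    (hf : IsSmoothOn f L Lbar (specNhd χ hH)) (R : Matrix (Fin k) (Fin n) ℂ)
    (hχ : ‖Rᴴ * R - H‖ ≤ χ) :
    ‖singularValueTransformation f (posSemidef_conjTranspose_mul_self R) -
      singularValueTransformation f hH‖ ≤ L * ‖Rᴴ * R - H‖ :=
  norm_singularValueTransformation_sub_le _ hH hL fun x hx y hy =>
    hf.lipschitz x (visibleEigenvalues_one_subset_specNhd hH _ hχ hx) y <|
      visibleEigenvalues_one_subset_specNhd hH H
        (by rw [sub_self, norm_zero]; exact (norm_nonneg _).trans hχ) hy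

theorem norm_conjTranspose_mul_singularValueTransformation_sub_mul_le (hLbar : 0 ≤ Lbar)
    (hH : H.PosSemidef) (hf : IsSmoothOn f L Lbar (specNhd χ hH)) (R : Matrix (Fin k) (Fin n) ℂ)
    (W : Matrix (Fin n) (Fin l) ℂ)
    (hχ : ‖Rᴴ * R - H‖ + ‖R * W * (R * W)ᴴ - R * Rᴴ‖ ≤ χ) :
    ‖Rᴴ * (singularValueTransformation (fbar f) (posSemidef_self_mul_conjTranspose (R * W)) -
        singularValueTransformation (fbar f) (posSemidef_self_mul_conjTranspose R)) * R‖ ≤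
      Lbar * ‖R‖ ^ 2 * ‖R * W * (R * W)ᴴ - R * Rᴴ‖ := by
  have hRR : visibleEigenvalues Rᴴ (R * Rᴴ) ⊆ specNhd ‖Rᴴ * R - H‖ hH :=
    (visibleEigenvalues_self_mul_conjTranspose_subset R).trans
      (visibleEigenvalues_one_subset_specNhd hH _ le_rfl)
  have hRR' : visibleEigenvalues Rᴴ (R * Rᴴ) ⊆ specNhd χ hH := fun y hy =>
    mem_specNhd_of_abs_sub_le (hRR hy) <| by
      rw [sub_self, abs_zero, add_zero]
      exact le_of_add_le_of_nonneg_left hχ (norm_nonneg _)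
  have hRW : visibleEigenvalues Rᴴ (R * W * (R * W)ᴴ) ⊆ specNhd χ hH := by
    intro x hx
    have hassoc : R * W * (R * W)ᴴ = R * (W * Wᴴ) * Rᴴ := by
      simp only [conjTranspose_mul, Matrix.mul_assoc]
    rw [hassoc] at hx hχ
    obtain ⟨y, hy, hxy⟩ := exists_mem_visibleEigenvalues_abs_sub_le R hx
    exact mem_specNhd_of_abs_sub_le (hRR hy) (by linarith)
  obtain ⟨N, hN, h⟩ := exists_norm_le_and_mul_sub_mul_eq
    (posSemidef_self_mul_conjTranspose (R * W)) (posSemidef_self_mul_conjTranspose R)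
    (P := Rᴴ) (Q := R) hLbar fun x hx y hy => hf.lipschitz_fbar x (hRW hx) y (hRR' hy)
  rw [h]
  calc ‖Rᴴ * N * R‖ ≤ ‖Rᴴ‖ * ‖N‖ * ‖R‖ :=
        (frobenius_norm_mul _ _).trans (by gcongr; exact frobenius_norm_mul _ _)
    _ = ‖R‖ ^ 2 * ‖N‖ := by rw [frobenius_norm_conjTranspose]; ring
    _ ≤ ‖R‖ ^ 2 * (Lbar * ‖R * W * (R * W)ᴴ - R * Rᴴ‖) := by gcongr
    _ = Lbar * ‖R‖ ^ 2 * ‖R * W * (R * W)ᴴ - R * Rᴴ‖ := by ring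

theorem norm_sketched_singularValueTransformation_sub_le (hL : 0 ≤ L) (hLbar : 0 ≤ Lbar)
    (hH : H.PosSemidef) (hf : IsSmoothOn f L Lbar (specNhd χ hH)) (R : Matrix (Fin k) (Fin n) ℂ)
    (W : Matrix (Fin n) (Fin l) ℂ)
    (hχ : ‖Rᴴ * R - H‖ + ‖R * W * (R * W)ᴴ - R * Rᴴ‖ ≤ χ) :
    ‖Rᴴ * singularValueTransformation (fbar f) (posSemidef_self_mul_conjTranspose (R * W)) * R -
        singularValueTransformation f hH‖ ≤
      Lbar * ‖R‖ ^ 2 * ‖R * W * (R * W)ᴴ - R * Rᴴ‖ + L * ‖Rᴴ * R - H‖ := by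
  have hχ' : ‖Rᴴ * R - H‖ ≤ χ := le_of_add_le_of_nonneg_left hχ (norm_nonneg _)
  refine le_trans (le_of_eq ?_) <| norm_add_le_of_le
    (norm_conjTranspose_mul_singularValueTransformation_sub_mul_le hLbar hH hf R W hχ)
    (norm_singularValueTransformation_gram_sub_le hL hH hf R hχ')
  rw [Matrix.mul_sub, Matrix.sub_mul, conjTranspose_mul_singularValueTransformation_mul
    (mul_fbar hf.map_zero) R, sub_add_sub_cancel]

end Perturbation

section RowGram

open Matrix

variable {m n r : ℕ}

/-- The contribution `A(i,·)† A(i,·)` of the `i`-th row of `A` to the Gram matrix `Aᴴ * A`. -/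
def rowGram (A : Matrix (Fin m) (Fin n) ℂ) (i : Fin m) : Matrix (Fin n) (Fin n) ℂ :=
  vecMulVec (star (A i)) (A i)

theorem sum_rowGram (A : Matrix (Fin m) (Fin n) ℂ) : ∑ i, rowGram A i = Aᴴ * A := by
  ext a b
  rw [Matrix.sum_apply, mul_apply]
  rfl

theorem norm_rowGram (A : Matrix (Fin m) (Fin n) ℂ) (i : Fin m) :
    ‖rowGram A i‖ = ∑ j, ‖A i j‖ ^ 2 := by
  refine (sq_eq_sq₀ (norm_nonneg _) (by positivity)).1 ?_
  rw [frobenius_norm_sq, sq (∑ j, _), Finset.sum_mul_sum]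
  simp only [rowGram, vecMulVec_apply, norm_mul, Pi.star_apply, norm_star, mul_pow]

theorem sum_norm_rowGram (A : Matrix (Fin m) (Fin n) ℂ) : ∑ i, ‖rowGram A i‖ = ‖A‖ ^ 2 := by
  simp only [norm_rowGram, frobenius_norm_sq]

theorem norm_rowGram_eq_rowDist_mul (A : Matrix (Fin m) (Fin n) ℂ) (i : Fin m) :
    ‖rowGram A i‖ = rowDist A i * ‖A‖ ^ 2 := by
  rw [rowDist, ← norm_rowGram]
  refine (div_mul_cancel_of_imp fun h => le_antisymm ?_ (norm_nonneg _)).symm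
  rw [← h, ← sum_norm_rowGram]
  exact Finset.single_le_sum (f := fun i => ‖rowGram A i‖) (fun _ _ => norm_nonneg _)
    (Finset.mem_univ i)

/-- The unbiased estimate `A(i,·)† A(i,·) / p(i)` of the Gram matrix `Aᴴ * A` from a row index `i`
of distribution `p`; it is `0` where `p i = 0`. -/
noncomputable def weightedRowGram (p : Fin m → ℝ) (A : Matrix (Fin m) (Fin n) ℂ) (i : Fin m) :
    Matrix (Fin n) (Fin n) ℂ :=
  (p i)⁻¹ • rowGram A i

variable {p : Fin m → ℝ} {A : Matrix (Fin m) (Fin n) ℂ} {M : ℝ}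

theorem norm_weightedRowGram_le (hp : ∀ i, 0 ≤ p i) (hM : 0 ≤ M)
    (h : ∀ i, ‖rowGram A i‖ ≤ M * p i) (i : Fin m) : ‖weightedRowGram p A i‖ ≤ M := by
  rw [weightedRowGram, norm_smul, norm_inv, Real.norm_of_nonneg (hp i), inv_mul_eq_div]
  exact div_le_of_le_mul₀ (hp i) hM (h i)

theorem smul_weightedRowGram (h : ∀ i, ‖rowGram A i‖ ≤ M * p i) (i : Fin m) :
    p i • weightedRowGram p A i = rowGram A i := by
  rcases eq_or_ne (p i) 0 with hpi | hpi
  · have h0 : rowGram A i = 0 := norm_le_zero_iff.1 ((h i).trans_eq (by rw [hpi, mul_zero]))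
    rw [hpi, h0, zero_smul]
  · rw [weightedRowGram, smul_inv_smul₀ hpi]

theorem rowGram_sketchR (hp : ∀ i, 0 ≤ p i) (s : Fin r → Fin m) (A : Matrix (Fin m) (Fin n) ℂ)
    (k : Fin r) :
    rowGram (sketchR (sampleMatrix p s) A) k = (r : ℝ)⁻¹ • weightedRowGram p A (s k) := by
  set w : ℝ := if 0 < p (s k) then 1 / √((r : ℝ) * p (s k)) else 0 with hw
  have hrow (j) : sketchR (sampleMatrix p s) A k j = (w : ℂ) * A (s k) j := by
    rw [sketchR, mul_apply, Finset.sum_eq_single (s k)]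
    · simp [sampleMatrix, hw]
    · intro b _ hb
      simp [sampleMatrix, hb]
    · simp
  have hw2 : w * w = (r : ℝ)⁻¹ * (p (s k))⁻¹ := by
    rw [hw]
    split_ifs with h
    · rw [div_mul_div_comm, Real.mul_self_sqrt (by positivity), one_mul, one_div, mul_inv]
    · rw [le_antisymm (not_lt.1 h) (hp _), _root_.inv_zero, mul_zero, mul_zero]
  ext a b
  rw [weightedRowGram, smul_smul, ← hw2]
  simp only [rowGram, vecMulVec_apply, Pi.star_apply, hrow, Matrix.smul_apply, Complex.real_smul,
    star_mul', Complex.star_def, Complex.conj_ofReal, Complex.ofReal_mul]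
  ring

theorem conjTranspose_sketchR_mul_sketchR (hp : ∀ i, 0 ≤ p i) (s : Fin r → Fin m)
    (A : Matrix (Fin m) (Fin n) ℂ) :
    (sketchR (sampleMatrix p s) A)ᴴ * sketchR (sampleMatrix p s) A =
      (r : ℝ)⁻¹ • ∑ k, weightedRowGram p A (s k) := by
  simp only [← sum_rowGram, rowGram_sketchR hp, Finset.smul_sum]

theorem norm_sketchR_sq (hp : ∀ i, 0 ≤ p i) (s : Fin r → Fin m) (A : Matrix (Fin m) (Fin n) ℂ) :
    ‖sketchR (sampleMatrix p s) A‖ ^ 2 = (r : ℝ)⁻¹ * ∑ k, ‖weightedRowGram p A (s k)‖ := by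
  simp only [← sum_norm_rowGram, rowGram_sketchR hp, norm_smul, Finset.mul_sum, norm_inv,
    Real.norm_natCast]

end RowGram

section IndependentSample

variable {Ω : Type*} [MeasurableSpace Ω] {P : Measure Ω} {m r : ℕ} {p pt : Fin m → ℝ} {M : ℝ}

theorem norm_sum_smul_sub_sum_smul_le {E : Type*} [SeminormedAddCommGroup E] [NormedSpace ℝ E]
    {x : Fin m → E} (hx : ∀ i, ‖x i‖ ≤ M) :
    ‖∑ i, pt i • x i - ∑ i, p i • x i‖ ≤ 2 * tvDist pt p * M := by
  calc ‖∑ i, pt i • x i - ∑ i, p i • x i‖ = ‖∑ i, (pt i - p i) • x i‖ := by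
        simp only [sub_smul, Finset.sum_sub_distrib]
    _ ≤ ∑ i, |pt i - p i| * M := norm_sum_le_of_le _ fun i _ => by
        rw [norm_smul, Real.norm_eq_abs]
        gcongr
        exact hx i
    _ = 2 * tvDist pt p * M := by
        rw [← Finset.sum_mul, tvDist]
        ring

/-- The indices `s 1, …, s r` drawn in a sketch: independent, each with distribution `pt`. -/
structure IsIndependentSample (P : Measure Ω) (pt : Fin m → ℝ) (s : Fin r → Ω → Fin m) :
    Prop where
  measurable (k : Fin r) : Measurable (s k)
  iIndepFun : iIndepFun s P
  measure_eq (k : Fin r) (j : Fin m) : P {ω | s k ω = j} = ENNReal.ofReal (pt j)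

namespace IsIndependentSample

variable [IsProbabilityMeasure P] {s : Fin r → Ω → Fin m}

theorem integral_comp {E : Type*} [NormedAddCommGroup E] [NormedSpace ℝ E] [CompleteSpace E]
    (hs : IsIndependentSample P pt s) (hpt : ∀ j, 0 ≤ pt j) (x : Fin m → E) (k : Fin r) :
    ∫ ω, x (s k ω) ∂P = ∑ j, pt j • x j := by
  have := Measure.isProbabilityMeasure_map (μ := P) (hs.measurable k).aemeasurable
  rw [← integral_map (hs.measurable k).aemeasurable
    (StronglyMeasurable.of_discrete (f := x)).aestronglyMeasurable,
    integral_fintype Integrable.of_finite]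
  refine Finset.sum_congr rfl fun j _ => ?_
  rw [measureReal_def, Measure.map_apply (hs.measurable k) (measurableSet_singleton j)]
  change (P {ω | s k ω = j}).toReal • _ = _
  rw [hs.measure_eq, ENNReal.toReal_ofReal (hpt j)]

variable [NeZero r] {l : ℝ}

theorem measureReal_norm_average_sub_ge_le {E F : Type*} [NormedAddCommGroup E]
    [InnerProductSpace ℝ E] [CompleteSpace E] [MeasurableSpace E] [BorelSpace E]
    [SecondCountableTopology E] [SeminormedAddCommGroup F] [NormedSpace ℝ F]
    (hs : IsIndependentSample P pt s) (hpt : ∀ j, 0 ≤ pt j) (e : F →ₗᵢ[ℝ] E) {x : Fin m → F}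
    (hM : 0 < M) (hx : ∀ i, ‖x i‖ ≤ M) (hl : 0 ≤ l) :
    P.real {ω | M * √(8 * l / r) ≤ ‖(r : ℝ)⁻¹ • ∑ k, x (s k ω) - ∑ j, pt j • x j‖} ≤
      2 * Real.exp (-l) := by
  have hm : Measurable fun i => e (x i) := measurable_of_countable _
  have := _root_.measureReal_norm_average_sub_ge_le (X := fun k ω => e (x (s k ω)))
    (hs.iIndepFun.comp (fun _ i => e (x i)) fun _ => hm)
    (fun k => (hm.comp (hs.measurable k)).aemeasurable) hM
    (fun k => ae_of_all _ fun ω => (e.norm_map _).trans_le (hx _))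
    (fun k => hs.integral_comp hpt (fun i => e (x i)) k) hl
  simpa only [Fintype.card_fin, ← map_smul, ← map_sum, ← map_sub, e.norm_map] using this

theorem measureReal_average_ge_le (hs : IsIndependentSample P pt s) (hpt : ∀ j, 0 ≤ pt j)
    {x : Fin m → ℝ} (hM : 0 < M) (hx : ∀ i, x i ∈ Set.Icc 0 M) (hl : 0 ≤ l) :
    P.real {ω | ∑ j, pt j * x j + M * √(l / (2 * r)) ≤ (r : ℝ)⁻¹ * ∑ k, x (s k ω)} ≤
      Real.exp (-l) := by
  have hm : Measurable x := measurable_of_countable _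
  have := _root_.measureReal_average_ge_le (X := fun k ω => x (s k ω))
    (hs.iIndepFun.comp (fun _ => x) fun _ => hm)
    (fun k => (hm.comp (hs.measurable k)).aemeasurable) hM (fun k => ae_of_all _ fun ω => hx _)
    (hs.integral_comp hpt x) hl
  simpa only [Fintype.card_fin, smul_eq_mul] using this

end IsIndependentSample

end IndependentSample

section Sketch

open Matrix

variable {Ω : Type*} [MeasurableSpace Ω] {P : Measure Ω} {m n r : ℕ} {ε φ l : ℝ}
  {A : Matrix (Fin m) (Fin n) ℂ}

namespace IsApproxImportanceSketch

variable {S : Ω → Matrix (Fin r) (Fin m) ℝ}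

theorem exists_isIndependentSample (hS : IsApproxImportanceSketch P ε φ A S) (hφ : 0 < φ) :
    ∃ (p pt : Fin m → ℝ) (s : Fin r → Ω → Fin m), (∀ i, 0 ≤ p i) ∧ (∀ i, 0 ≤ pt i) ∧
      (∀ i, ‖rowGram A i‖ ≤ φ * ‖A‖ ^ 2 * p i) ∧ tvDist pt p ≤ ε ∧
      IsIndependentSample P pt s ∧ ∀ᵐ ω ∂P, S ω = sampleMatrix p fun k => s k ω := by
  obtain ⟨p, hp, pt, hpt, hrow, htv, s, hsm, hsind, hslaw, hae⟩ := hS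
  refine ⟨p, pt, s, hp.1, hpt.1, fun i => ?_, htv, ⟨hsm, hsind, hslaw⟩, hae⟩
  have hi : rowDist A i ≤ φ * p i := by
    rw [← div_le_iff₀' hφ, ← one_div_mul_eq_div]
    exact hrow i
  rw [norm_rowGram_eq_rowDist_mul, mul_right_comm]
  gcongr

theorem exists_finset_ae_mem (hS : IsApproxImportanceSketch P ε φ A S) :
    ∃ F : Finset (Matrix (Fin r) (Fin m) ℝ), ∀ᵐ ω ∂P, S ω ∈ F := by
  classical
  obtain ⟨p, -, -, -, -, -, s, -, -, -, hae⟩ := hS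
  exact ⟨Finset.univ.image (sampleMatrix p), hae.mono fun ω hω =>
    Finset.mem_image.2 ⟨_, Finset.mem_univ _, hω.symm⟩⟩

variable [IsProbabilityMeasure P] [NeZero r]

theorem measureReal_lt_norm_gram_sub_le (hS : IsApproxImportanceSketch P ε φ A S) (hA : A ≠ 0)
    (hφ : 0 < φ) (hl : 0 ≤ l) :
    P.real {ω | 2 * ε * (φ * ‖A‖ ^ 2) + φ * ‖A‖ ^ 2 * √(8 * l / r) <
      ‖(sketchR (S ω) A)ᴴ * sketchR (S ω) A - Aᴴ * A‖} ≤ 2 * Real.exp (-l) := by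
  obtain ⟨p, pt, s, hp, hpt, hrow, htv, hs, hae⟩ := hS.exists_isIndependentSample hφ
  have hM : 0 < φ * ‖A‖ ^ 2 := by have := norm_pos_iff.2 hA; positivity
  set M := φ * ‖A‖ ^ 2
  have hw := norm_weightedRowGram_le hp hM.le hrow
  have hbias : ‖∑ j, pt j • weightedRowGram p A j - Aᴴ * A‖ ≤ 2 * ε * M := by
    have := norm_sum_smul_sub_sum_smul_le (pt := pt) (p := p) hw
    simp only [smul_weightedRowGram hrow, sum_rowGram] at this
    exact this.trans (by gcongr)
  refine (ENNReal.toReal_mono (measure_ne_top _ _) (measure_mono_ae ?_)).trans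
    (hs.measureReal_norm_average_sub_ge_le hpt (frobeniusIsometry n n) hM hw hl)
  filter_upwards [hae] with ω hω hlt
  change _ < ‖_‖ at hlt
  rw [hω, conjTranspose_sketchR_mul_sketchR hp] at hlt
  change _ ≤ ‖_‖
  linarith [norm_sub_le_norm_sub_add_norm_sub ((r : ℝ)⁻¹ • ∑ k, weightedRowGram p A (s k ω))
    (∑ j, pt j • weightedRowGram p A j) (Aᴴ * A)]

theorem measureReal_lt_norm_sq_le (hS : IsApproxImportanceSketch P ε φ A S) (hA : A ≠ 0)
    (hφ : 0 < φ) (hl : 0 ≤ l) :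
    P.real {ω | ‖A‖ ^ 2 + 2 * ε * (φ * ‖A‖ ^ 2) + φ * ‖A‖ ^ 2 * √(l / (2 * r)) <
      ‖sketchR (S ω) A‖ ^ 2} ≤ Real.exp (-l) := by
  obtain ⟨p, pt, s, hp, hpt, hrow, htv, hs, hae⟩ := hS.exists_isIndependentSample hφ
  have hM : 0 < φ * ‖A‖ ^ 2 := by have := norm_pos_iff.2 hA; positivity
  set M := φ * ‖A‖ ^ 2
  have hw := norm_weightedRowGram_le hp hM.le hrow
  have hbias : ∑ j, pt j * ‖weightedRowGram p A j‖ - ‖A‖ ^ 2 ≤ 2 * ε * M := by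
    have hsum : ∑ j, p j * ‖weightedRowGram p A j‖ = ‖A‖ ^ 2 := by
      rw [← sum_norm_rowGram]
      refine Finset.sum_congr rfl fun j _ => ?_
      rw [← smul_weightedRowGram hrow, norm_smul, Real.norm_of_nonneg (hp j)]
    have := norm_sum_smul_sub_sum_smul_le (pt := pt) (p := p) fun j => (norm_norm _).trans_le (hw j)
    simp only [smul_eq_mul, hsum] at this
    exact (le_abs_self _).trans (this.trans (by gcongr))
  refine (ENNReal.toReal_mono (measure_ne_top _ _) (measure_mono_ae ?_)).trans
    (hs.measureReal_average_ge_le hpt hM (fun i => ⟨norm_nonneg _, hw i⟩) hl)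
  filter_upwards [hae] with ω hω hlt
  change _ < _ ^ 2 at hlt
  rw [hω, norm_sketchR_sq hp] at hlt
  change _ ≤ _ * _
  linarith

end IsApproxImportanceSketch

end Sketch

theorem measureReal_le_of_cond_le {Ω α : Type*} [MeasurableSpace Ω] {P : Measure Ω}
    [IsProbabilityMeasure P] {X : Ω → α} (hX : ∀ a, MeasurableSet (X ⁻¹' {a})) {F : Finset α}
    (hF : ∀ᵐ ω ∂P, X ω ∈ F) {B : Set Ω} {b : ℝ} (hb : 0 ≤ b)
    (h : ∀ a, P (X ⁻¹' {a}) ≠ 0 → (P[|X ⁻¹' {a}]).real B ≤ b) : P.real B ≤ b := by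
  have hfibre (a : α) : P.real (X ⁻¹' {a} ∩ B) ≤ P.real (X ⁻¹' {a}) * b := by
    by_cases ha : P (X ⁻¹' {a}) = 0
    · have h0 : P.real (X ⁻¹' {a}) = 0 := by rw [measureReal_def, ha, ENNReal.toReal_zero]
      rw [h0, zero_mul, ← h0]
      exact measureReal_mono Set.inter_subset_left
    · rw [measureReal_def, ← cond_mul_eq_inter (hX a), ENNReal.toReal_mul, mul_comm]
      exact mul_le_mul_of_nonneg_left (h a ha) measureReal_nonneg
  calc P.real B ≤ P.real (⋃ a ∈ F, X ⁻¹' {a} ∩ B) := by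
        refine ENNReal.toReal_mono (measure_ne_top _ _) (measure_mono_ae ?_)
        filter_upwards [hF] with ω hω hB
        exact Set.mem_biUnion (s := (F : Set α)) hω ⟨rfl, hB⟩
    _ ≤ ∑ a ∈ F, P.real (X ⁻¹' {a} ∩ B) := measureReal_biUnion_finset_le _ _
    _ ≤ ∑ a ∈ F, P.real (X ⁻¹' {a}) * b := Finset.sum_le_sum fun a _ => hfibre a
    _ = P.real (⋃ a ∈ F, X ⁻¹' {a}) * b := by
        rw [← Finset.sum_mul, measureReal_biUnion_finset
          (fun x _ y _ hxy => Disjoint.preimage X (Set.disjoint_singleton.2 hxy)) fun a _ => hX a]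
    _ ≤ b := mul_le_of_le_one_left hb measureReal_le_one

section SecondSketch

variable {Ω : Type*} [MeasurableSpace Ω] {P : Measure Ω} [IsProbabilityMeasure P] {m n r c : ℕ}
  {A : Matrix (Fin m) (Fin n) ℂ} {ε φ φ' l : ℝ}

theorem sketchC_mul_conjTranspose (S : Matrix (Fin r) (Fin m) ℝ) (A : Matrix (Fin m) (Fin n) ℂ)
    (T : Matrix (Fin c) (Fin n) ℝ) :
    sketchC S A T * (sketchC S A T)ᴴ =
      (sketchR T (sketchR S A)ᴴ)ᴴ * sketchR T (sketchR S A)ᴴ := by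
  simp only [sketchC, sketchR, Matrix.conjTranspose_mul, Matrix.conjTranspose_conjTranspose]

theorem measureReal_lt_norm_sketchC_gram_sub_le [NeZero c] (hφ' : 0 < φ')
    {S : Ω → Matrix (Fin r) (Fin m) ℝ} {T : Ω → Matrix (Fin c) (Fin n) ℝ}
    (hSmeas : ∀ i j, Measurable fun ω => S ω i j) (hS : IsApproxImportanceSketch P ε φ A S)
    (hT : ∀ S₀ : Matrix (Fin r) (Fin m) ℝ, P (S ⁻¹' {S₀}) ≠ 0 → sketchR S₀ A ≠ 0 →
      IsApproxImportanceSketch (P[|S ⁻¹' {S₀}]) ε φ' (sketchR S₀ A)ᴴ T)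
    (hl : 0 ≤ l) :
    P.real {ω | 2 * ε * (φ' * ‖sketchR (S ω) A‖ ^ 2) +
        φ' * ‖sketchR (S ω) A‖ ^ 2 * √(8 * l / c) <
      ‖sketchC (S ω) A (T ω) * (sketchC (S ω) A (T ω))ᴴ -
        sketchR (S ω) A * (sketchR (S ω) A)ᴴ‖} ≤ 2 * Real.exp (-l) := by
  have hfibre (S₀ : Matrix (Fin r) (Fin m) ℝ) : MeasurableSet (S ⁻¹' {S₀}) := by
    have hS' : Measurable fun ω i j => S ω i j :=
      measurable_pi_lambda _ fun i => measurable_pi_lambda _ (hSmeas i)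
    exact hS' (measurableSet_singleton fun i j => S₀ i j)
  obtain ⟨F, hF⟩ := hS.exists_finset_ae_mem
  refine measureReal_le_of_cond_le hfibre hF (by positivity) fun S₀ hS₀ => ?_
  have := cond_isProbabilityMeasure hS₀
  set bad : Set Ω := {ω | 2 * ε * (φ' * ‖(sketchR S₀ A)ᴴ‖ ^ 2) +
      φ' * ‖(sketchR S₀ A)ᴴ‖ ^ 2 * √(8 * l / c) <
    ‖(sketchR (T ω) (sketchR S₀ A)ᴴ)ᴴ * sketchR (T ω) (sketchR S₀ A)ᴴ -
      (sketchR S₀ A)ᴴᴴ * (sketchR S₀ A)ᴴ‖} with hbad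
  have hle : (P[|S ⁻¹' {S₀}]).real bad ≤ 2 * Real.exp (-l) := by
    by_cases hR : sketchR S₀ A = 0
    · have hTR (ω : Ω) : sketchR (T ω) (0 : Matrix (Fin n) (Fin r) ℂ) = 0 := Matrix.mul_zero _
      have : bad = ∅ := Set.eq_empty_of_forall_notMem fun ω => by simp [hbad, hR, hTR]
      rw [this, measureReal_empty]
      positivity
    · exact (hT S₀ hS₀ hR).measureReal_lt_norm_gram_sub_le
        (mt Matrix.conjTranspose_eq_zero.1 hR) hφ' hl
  refine (ENNReal.toReal_mono (measure_ne_top _ _) (measure_mono_ae ?_)).trans hle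
  filter_upwards [ae_cond_mem (hfibre S₀)] with ω (hω : S ω = S₀) hlt
  change _ < ‖_‖ at hlt
  rw [hω, sketchC_mul_conjTranspose] at hlt
  change _ < ‖_‖
  rwa [Matrix.frobenius_norm_conjTranspose, Matrix.conjTranspose_conjTranspose]

end SecondSketch

section ErrorBudget

-- The fraction `3 / 11` satisfies `8 / 112 ≤ (3 / 11) ^ 2` and `(1 + 7 / 4) * (3 / 11) = 3 / 4`,
-- which leaves a quarter of the budget `χ` to the sampling bias.
theorem mul_sqrt_le_of_sample_size {M l t k : ℝ} (hM : 0 ≤ M) (hl : 0 ≤ l) (ht : 0 < t)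
    (hk : 0 < k) (h : 112 * M ^ 2 * (l / t ^ 2) ≤ k) : M * √(8 * l / k) ≤ 3 / 11 * t := by
  refine (sq_le_sq₀ (by positivity) (by positivity)).1 ?_
  rw [mul_pow, Real.sq_sqrt (by positivity), mul_div_assoc', div_le_iff₀ hk]
  rw [mul_div_assoc', div_le_iff₀ (by positivity)] at h
  nlinarith [mul_nonneg hk.le (sq_nonneg t)]

theorem deviation_le_of_sample_size {M l χ γ w k : ℝ} (hM : 0 ≤ M) (hl : 0 ≤ l) (hχ : 0 < χ)
    (hγ : 0 < γ) (hw : 0 < w) (hk : 0 < k)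
    (h : 112 * M ^ 2 * (l / χ ^ 2 + l * w ^ 2 / γ ^ 2) ≤ k) :
    M * √(8 * l / k) ≤ 3 / 11 * χ ∧ w * (M * √(8 * l / k)) ≤ 3 / 11 * γ := by
  have hχk : 112 * M ^ 2 * (l / χ ^ 2) ≤ k := h.trans' <| by
    gcongr
    exact le_add_of_nonneg_right (by positivity)
  have hγk : 112 * M ^ 2 * (l / (γ / w) ^ 2) ≤ k := h.trans' <| by
    rw [div_pow, div_div_eq_mul_div]
    gcongr
    exact le_add_of_nonneg_left (by positivity)
  have hdev := mul_sqrt_le_of_sample_size hM hl (div_pos hγ hw) hk hγk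
  refine ⟨mul_sqrt_le_of_sample_size hM hl hχ hk hχk, ?_⟩
  calc w * (M * √(8 * l / k)) ≤ w * (3 / 11 * (γ / w)) := by gcongr
    _ = 3 / 11 * γ := by field_simp

variable {ε φ φ' a ρ l r χ γ L Lbar η₁ η₂ d₁ d₂ : ℝ}

theorem sq_norm_budget (ha : 0 ≤ a) (hφ : 0 < φ) (hl : 0 ≤ l) (hr : 0 < r)
    (hε : ε * (8 * φ) ≤ 1) (hrl : 2 * φ ^ 2 * l ≤ r)
    (hρ : ρ ≤ a + 2 * ε * (φ * a) + φ * a * √(l / (2 * r))) : ρ ≤ 7 / 4 * a := by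
  have hsqrt : φ * √(l / (2 * r)) ≤ 1 / 2 := by
    refine (sq_le_sq₀ (by positivity) (by norm_num)).1 ?_
    rw [mul_pow, Real.sq_sqrt (by positivity), mul_div_assoc', div_le_iff₀ (by positivity)]
    linarith
  have hbias : ε * φ * a ≤ 1 / 8 * a := by
    gcongr
    linarith
  have hdev : φ * √(l / (2 * r)) * a ≤ 1 / 2 * a := by gcongr
  linarith

theorem spectral_budget (hχ : 0 ≤ χ) (hbias : 0 ≤ ε * φ * a) (hε : ε * (24 * (φ + φ') * a) ≤ χ)
    (hη₁ : η₁ ≤ 3 / 11 * χ) (hη₂ : η₂ ≤ 3 / 11 * χ)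
    (hd₁ : d₁ ≤ 2 * ε * (φ * a) + η₁) (hd₂ : d₂ ≤ 7 / 4 * (2 * ε * (φ' * a) + η₂)) :
    d₁ + d₂ ≤ χ := by
  linarith

theorem frobenius_budget (ha : 0 ≤ a) (hL : 0 < L) (hLbar : 0 < Lbar) (hγ : 0 ≤ γ) (hd₀ : 0 ≤ d₂)
    (hε₁ : ε * (24 * L * φ * a) ≤ γ) (hε₂ : ε * (48 * Lbar * φ' * a ^ 2) ≤ γ)
    (hη₁ : L * η₁ ≤ 3 / 11 * γ) (hη₂ : 2 * Lbar * a * η₂ ≤ 3 / 11 * γ) (hρ : ρ ≤ 7 / 4 * a)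
    (hd₁ : d₁ ≤ 2 * ε * (φ * a) + η₁) (hd₂ : d₂ ≤ 7 / 4 * (2 * ε * (φ' * a) + η₂)) :
    Lbar * ρ * d₂ + L * d₁ ≤ γ := by
  have hfirst : L * d₁ ≤ 1 / 12 * γ + 3 / 11 * γ := by
    calc L * d₁ ≤ L * (2 * ε * (φ * a) + η₁) := by gcongr
      _ ≤ _ := by linarith
  have hsecond : Lbar * ρ * d₂ ≤ 49 / 16 * (1 / 24 * γ + 3 / 22 * γ) := by
    calc Lbar * ρ * d₂ ≤ Lbar * (7 / 4 * a) * (7 / 4 * (2 * ε * (φ' * a) + η₂)) := by gcongr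
      _ ≤ _ := by linarith
  linarith

end ErrorBudget

section SketchedTransformation

variable {m n r c : ℕ} {A : Matrix (Fin m) (Fin n) ℂ} {f : ℝ≥0 → ℂ} {L Lbar χ γ φ φ' ε l : ℝ}

theorem norm_sketched_singularValueTransformation_sub_le_of_concentrated (hA : A ≠ 0)
    (hL : 0 < L) (hLbar : 0 < Lbar) (hχ : 0 < χ) (hγ : 0 < γ) (hφ : 0 < φ) (hφ' : 0 < φ')
    (hε : 0 ≤ ε) (hl : 0 ≤ l) (hr : 0 < r) (hc : 0 < c)
    (hf : IsSmoothOn f L Lbar (specNhd χ (Matrix.posSemidef_conjTranspose_mul_self A)))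
    (cond_ε : ε ≤ min (min (1 / (8 * φ)) (χ / (24 * (φ + φ') * ‖A‖ ^ 2)))
      (min (γ / (24 * L * φ * ‖A‖ ^ 2)) (γ / (48 * Lbar * φ' * ‖A‖ ^ 4))))
    (cond_r : max (2 * φ ^ 2 * l)
      (112 * φ ^ 2 * ‖A‖ ^ 4 * (l / χ ^ 2 + l * L ^ 2 / γ ^ 2)) ≤ (r : ℝ))
    (cond_c : 112 * φ' ^ 2 * ‖A‖ ^ 4 *
      (l / χ ^ 2 + 4 * l * Lbar ^ 2 * ‖A‖ ^ 4 / γ ^ 2) ≤ (c : ℝ))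
    {R : Matrix (Fin r) (Fin n) ℂ} {W : Matrix (Fin n) (Fin c) ℂ}
    (hnorm : ‖R‖ ^ 2 ≤ ‖A‖ ^ 2 + 2 * ε * (φ * ‖A‖ ^ 2) + φ * ‖A‖ ^ 2 * √(l / (2 * r)))
    (hgram : ‖Rᴴ * R - Aᴴ * A‖ ≤ 2 * ε * (φ * ‖A‖ ^ 2) + φ * ‖A‖ ^ 2 * √(8 * l / r))
    (hgram' : ‖R * W * (R * W)ᴴ - R * Rᴴ‖ ≤
      2 * ε * (φ' * ‖R‖ ^ 2) + φ' * ‖R‖ ^ 2 * √(8 * l / c)) :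
    ‖Rᴴ * singularValueTransformation (fbar f)
        (Matrix.posSemidef_self_mul_conjTranspose (R * W)) * R -
      singularValueTransformation f (Matrix.posSemidef_conjTranspose_mul_self A)‖ ≤ γ := by
  have ha : 0 < ‖A‖ ^ 2 := pow_pos (norm_pos_iff.2 hA) 2
  rw [show ‖A‖ ^ 4 = (‖A‖ ^ 2) ^ 2 by ring] at cond_ε cond_r cond_c
  set a := ‖A‖ ^ 2
  simp only [le_min_iff] at cond_ε
  obtain ⟨⟨hε₁, hε₂⟩, hε₃, hε₄⟩ := cond_ε
  rw [le_div_iff₀ (by positivity)] at hε₁ hε₂ hε₃ hε₄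
  obtain ⟨hr₁, hr₂⟩ := max_le_iff.1 cond_r
  obtain ⟨hχ₁, hγ₁⟩ := deviation_le_of_sample_size (M := φ * a) (w := L) (by positivity) hl hχ hγ hL
    (Nat.cast_pos.2 hr) (by rwa [mul_pow, ← mul_assoc])
  obtain ⟨hχ₂, hγ₂⟩ := deviation_le_of_sample_size (M := φ' * a) (w := 2 * Lbar * a)
    (by positivity) hl hχ hγ (by positivity) (Nat.cast_pos.2 hc)
    (by convert cond_c using 1; ring)
  have hR : ‖R‖ ^ 2 ≤ 7 / 4 * a :=
    sq_norm_budget ha.le hφ hl (Nat.cast_pos.2 hr) hε₁ hr₁ hnorm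
  have hC : ‖R * W * (R * W)ᴴ - R * Rᴴ‖ ≤
      7 / 4 * (2 * ε * (φ' * a) + φ' * a * √(8 * l / c)) := by
    calc ‖R * W * (R * W)ᴴ - R * Rᴴ‖
        ≤ 2 * ε * (φ' * ‖R‖ ^ 2) + φ' * ‖R‖ ^ 2 * √(8 * l / c) := hgram'
      _ ≤ 2 * ε * (φ' * (7 / 4 * a)) + φ' * (7 / 4 * a) * √(8 * l / c) := by gcongr
      _ = _ := by ring
  exact (norm_sketched_singularValueTransformation_sub_le hL.le hLbar.le _ hf R W
    (spectral_budget hχ.le (by positivity) hε₂ hχ₁ hχ₂ hgram hC)).trans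
    (frobenius_budget ha.le hL hLbar hγ.le (norm_nonneg _) hε₃ hε₄ hγ₁ hγ₂ hR hgram hC)

end SketchedTransformation

theorem ofReal_one_sub_le_measure_of_union_bound {Ω : Type*} [MeasurableSpace Ω] {P : Measure Ω}
    [IsProbabilityMeasure P] {B₁ B₂ B₃ G : Set Ω} {b₁ b₂ b₃ δ : ℝ} (h₁ : P.real B₁ ≤ b₁)
    (h₂ : P.real B₂ ≤ b₂) (h₃ : P.real B₃ ≤ b₃) (hδ : b₁ + b₂ + b₃ ≤ δ)
    (hG : ∀ ω, ω ∉ B₁ → ω ∉ B₂ → ω ∉ B₃ → ω ∈ G) : ENNReal.ofReal (1 - δ) ≤ P G := by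
  have hcover : (Set.univ : Set Ω) ⊆ B₁ ∪ B₂ ∪ B₃ ∪ G := fun ω _ => by
    by_contra hω
    simp only [Set.mem_union, not_or] at hω
    exact hω.2 (hG ω hω.1.1.1 hω.1.1.2 hω.1.2)
  have hone : 1 ≤ P.real B₁ + P.real B₂ + P.real B₃ + P.real G := by
    calc 1 = P.real Set.univ := probReal_univ.symm
      _ ≤ P.real (B₁ ∪ B₂ ∪ B₃ ∪ G) := measureReal_mono hcover
      _ ≤ P.real (B₁ ∪ B₂ ∪ B₃) + P.real G := measureReal_union_le _ _
      _ ≤ P.real (B₁ ∪ B₂) + P.real B₃ + P.real G := by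
        gcongr
        exact measureReal_union_le _ _
      _ ≤ P.real B₁ + P.real B₂ + P.real B₃ + P.real G := by
        gcongr
        exact measureReal_union_le _ _
  refine ENNReal.ofReal_le_of_le_toReal ?_
  rw [← measureReal_def]
  linarith

theorem theorem3_general {m n : ℕ} (A : Matrix (Fin m) (Fin n) ℂ) (hA : A ≠ 0)
    (f : ℝ≥0 → ℂ) (L Lbar χ : ℝ) (hL : 0 < L) (hLbar : 0 < Lbar) (hχ : 0 < χ)
    (hf : IsSmoothOn f L Lbar (specNhd χ (Matrix.posSemidef_conjTranspose_mul_self A)))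
    (δ γ φ φ' ε : ℝ) (hδ : 0 < δ) (hδ1 : δ ≤ 1) (hγ : 0 < γ) (hφ : 0 < φ) (hφ' : 0 < φ')
    (hε : 0 ≤ ε) (r c : ℕ) (hr : 1 ≤ r) (hc : 1 ≤ c)
    (cond_ε : ε ≤ min (min (1 / (8 * φ)) (χ / (24 * (φ + φ') * ‖A‖ ^ 2)))
      (min (γ / (24 * L * φ * ‖A‖ ^ 2)) (γ / (48 * Lbar * φ' * ‖A‖ ^ 4))))
    (cond_r : max (2 * φ ^ 2 * Real.log (6 / δ))
      (112 * φ ^ 2 * ‖A‖ ^ 4 *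
        (Real.log (6 / δ) / χ ^ 2 + Real.log (6 / δ) * L ^ 2 / γ ^ 2)) ≤ (r : ℝ))
    (cond_c : 112 * φ' ^ 2 * ‖A‖ ^ 4 *
        (Real.log (6 / δ) / χ ^ 2 + 4 * Real.log (6 / δ) * Lbar ^ 2 * ‖A‖ ^ 4 / γ ^ 2) ≤ (c : ℝ))
    {Ω : Type*} [MeasurableSpace Ω] (P : Measure Ω) [IsProbabilityMeasure P]
    (S : Ω → Matrix (Fin r) (Fin m) ℝ) (T : Ω → Matrix (Fin c) (Fin n) ℝ)
    (hSmeas : ∀ i j, Measurable fun ω => S ω i j)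
    (hS : IsApproxImportanceSketch P ε φ A S)
    (hT : ∀ S₀ : Matrix (Fin r) (Fin m) ℝ, P (S ⁻¹' {S₀}) ≠ 0 → sketchR S₀ A ≠ 0 →
      IsApproxImportanceSketch (P[|S ⁻¹' {S₀}]) ε φ' (sketchR S₀ A)ᴴ T) :
    ENNReal.ofReal (1 - δ) ≤
      P {ω | ‖(sketchR (S ω) A)ᴴ *
            singularValueTransformation (fbar f)
              (Matrix.posSemidef_self_mul_conjTranspose (sketchC (S ω) A (T ω))) *
            sketchR (S ω) A -
          singularValueTransformation f (Matrix.posSemidef_conjTranspose_mul_self A)‖ ≤ γ} := by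
  have : NeZero r := ⟨by omega⟩
  have : NeZero c := ⟨by omega⟩
  have hl : 0 ≤ Real.log (6 / δ) := Real.log_nonneg (by rw [le_div_iff₀ hδ]; linarith)
  have hexp : Real.exp (-Real.log (6 / δ)) = δ / 6 := by
    rw [Real.exp_neg, Real.exp_log (by positivity), inv_div]
  have hnorm := hS.measureReal_lt_norm_sq_le hA hφ hl
  have hgram := hS.measureReal_lt_norm_gram_sub_le hA hφ hl
  have hgram' := measureReal_lt_norm_sketchC_gram_sub_le hφ' hSmeas hS hT hl
  rw [hexp] at hnorm hgram hgram'
  exact ofReal_one_sub_le_measure_of_union_bound hnorm hgram hgram' (by linarith)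
    fun ω hω₁ hω₂ hω₃ => norm_sketched_singularValueTransformation_sub_le_of_concentrated hA hL
      hLbar hχ hγ hφ hφ' hε hl hr hc hf cond_ε cond_r cond_c (not_lt.1 hω₁) (not_lt.1 hω₂)
      (not_lt.1 hω₃)

theorem theorem3 {m n : ℕ} (A : Matrix (Fin m) (Fin n) ℂ) (hA : A ≠ 0)
    (f : ℝ≥0 → ℂ) (L Lbar χ : ℝ) (hL : 0 < L) (hLbar : 0 < Lbar) (hχ : 0 < χ)
    (hf : IsSmoothOn f L Lbar (specNhd χ (Matrix.posSemidef_conjTranspose_mul_self A)))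
    (δ γ φ φ' ε : ℝ) (hδ : 0 < δ) (hδ1 : δ ≤ 1) (hγ : 0 < γ) (hφ : 1 ≤ φ) (hφ' : 1 ≤ φ')
    (hε : 0 ≤ ε) (r c : ℕ) (hr : 1 ≤ r) (hrm : r ≤ m) (hc : 1 ≤ c) (hcn : c ≤ n)
    (cond_ε : ε ≤ min (min (1 / (8 * φ)) (χ / (24 * (φ + φ') * ‖A‖ ^ 2)))
      (min (γ / (24 * L * φ * ‖A‖ ^ 2)) (γ / (48 * Lbar * φ' * ‖A‖ ^ 4))))
    (cond_r : max (2 * φ ^ 2 * Real.log (6 / δ))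
      (112 * φ ^ 2 * ‖A‖ ^ 4 *
        (Real.log (6 / δ) / χ ^ 2 + Real.log (6 / δ) * L ^ 2 / γ ^ 2)) ≤ (r : ℝ))
    (cond_c : 112 * φ' ^ 2 * ‖A‖ ^ 4 *
        (Real.log (6 / δ) / χ ^ 2 + 4 * Real.log (6 / δ) * Lbar ^ 2 * ‖A‖ ^ 4 / γ ^ 2) ≤ (c : ℝ))
    {Ω : Type*} [MeasurableSpace Ω] (P : Measure Ω) [IsProbabilityMeasure P]
    (S : Ω → Matrix (Fin r) (Fin m) ℝ) (T : Ω → Matrix (Fin c) (Fin n) ℝ)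
    (hSmeas : ∀ i j, Measurable fun ω => S ω i j) (hTmeas : ∀ i j, Measurable fun ω => T ω i j)
    (hS : IsApproxImportanceSketch P ε φ A S)
    (hT : ∀ S₀ : Matrix (Fin r) (Fin m) ℝ, P (S ⁻¹' {S₀}) ≠ 0 → sketchR S₀ A ≠ 0 →
      IsApproxImportanceSketch (P[|S ⁻¹' {S₀}]) ε φ' (sketchR S₀ A)ᴴ T) :
    ENNReal.ofReal (1 - δ) ≤
      P {ω | ‖(sketchR (S ω) A)ᴴ *
            singularValueTransformation (fbar f)
              (Matrix.posSemidef_self_mul_conjTranspose (sketchC (S ω) A (T ω))) *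
            sketchR (S ω) A -
          singularValueTransformation f (Matrix.posSemidef_conjTranspose_mul_self A)‖ ≤ γ} :=
  theorem3_general A hA f L Lbar χ hL hLbar hχ hf δ γ φ φ' ε hδ hδ1 hγ (by linarith) (by linarith)
    hε r c hr hc cond_ε cond_r cond_c P S T hSmeas hS hT
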